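/- Let $P^+$ be a probability measure on $\mathcal X\times\mathcal A$ with marginals $P_{\mathcal X},P_{\mathcal A}$, absolutely continuous with respect to $P_{\mathcal X}\otimes P_{\mathcal A}$ with density $r(x,a)=\frac{P^+(x,a)}{P_{\mathcal X}(x)P_{\mathcal A}(a)}$. Let $k_X^+(x,x')=\int r(x,a)r(x',a)\,dP_{\mathcal A}(a)$ be the dual kernel, let $\kappa\ge 0$ be given by $\kappa^2=\operatorname{ess\,sup}_{x\sim P_{\mathcal X}}k_X^+(x,x)$ (the context complexity), assumed finite, and let $$k(x,x')=k_X^+(x,x')-\int k_X^+(z,x')\,dP_{\mathcal X}(z)-\int k_X^+(x,z')\,dP_{\mathcal X}(z')+\iint k_X^+(z,z')\,dP_{\mathcal X}(z)\,dP_{\mathcal X}(z')$$ be the centered kernel of $k_X^+$. Let $s_1^2\ge s_2^2\ge\cdots\ge 0$ (with $s_i\ge 0$) be the eigenvalues, counted with multiplicity, of the integral operator $T_kf=\int f(x')k(\cdot,x')\,dP_{\mathcal X}(x')$ on $L^2(P_{\mathcal X})$, where the list of nonzero eigenvalues is continued by zeros if it is finite, and let $\mu_i$ (for $s_i>0$)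 be corresponding orthonormal eigenfunctions. Let $\mathcal H_k=\{\sum_i s_iu_i\mu_i:\sum_i u_i^2<\infty\}\subseteq L^2(P_{\mathcal X})$ with inner product $\langle\sum_i u_i\mu_i,\sum_i v_i\mu_i\rangle_{\mathcal H_k}=\sum_i u_iv_i/s_i^2$ (sums over $s_i>0$). For $f\in L^2(P_{\mathcal X})$ write $\tilde f=f-\mathbb E_{P_{\mathcal X}}[f]$, and for $0<\epsilon<1$ let $$\mathcal F_{\mathcal H_k}=\{f\in\mathcal H_k:\ \|\tilde f\|_{\mathcal H_k}\ge\|\tilde f\|_{P_{\mathcal X}}\ge(1-\epsilon)\|\tilde f\|_{\mathcal H_k}\},$$ where $\|\cdot\|_{P_{\mathcal X}}$ is the norm of $L^2(P_{\mathcal X})$. Let $m\ge 1$ and $0\le d\le m$, let $x_1,\dots,x_m$ be i.i.d. samples from $P_{\mathcal X}$, and let $G=(k(x_i,x_j))_{i,j}$ be their Gram matrix, with eigenvalues $\lambda_1\ge\cdots\ge\lambda_m$ and orthonormal eigenvectors $v_1,\dots,v_m$. If $\lambda_i>0$ for all $i\le d$, let $\Phi=[\phi_1,\dots,\phi_d]$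 with $\phi_i(x)=\lambda_i^{-1/2}\sum_{j=1}^m v_i[j]\,k(x,x_j)$. Suppose $(1-\epsilon)^2<s_1^2$, let $\delta\in(0,1)$, put $\eta=\frac{\kappa^2}{\sqrt m}\bigl(2\sqrt d+3\sqrt{\log(6/\delta)}\bigr)$, and suppose $s_1^2-s_{d+1}^2-\eta>0$. Then with probability at least $1-\delta$ over the samples the following holds, provided $\lambda_i>0$ for all $i\le d$, for every choice of the eigenvectors: $\phi_1,\dots,\phi_d\in\mathcal H_k$, and every $f^*\in\mathcal F_{\mathcal H_k}$ has a unique $\mathcal H_k$-orthogonal projection $f_\Phi$ onto $\operatorname{span}(\phi_1,\dots,\phi_d)$, which satisfies $$\|f^*-f_\Phi\|_{\mathcal H_k}^2\le\frac{s_1^2-(1-\epsilon)^2+s_1\sqrt{s_{d+1}^2+\eta}}{s_1^2-s_{d+1}^2-\eta}\cdot\frac{\|f^*\|_{P_{\mathcal X}}^2}{(1-\epsilon)^2},$$ $$\|f^*-f_\Phi\|_{P_{\mathcal X}}^2\le\frac{s_1^2-(1-\epsilon)^2+s_1\sqrt{s_{d+1}^2+\eta}}{s_1^2-s_{d+1}^2-\eta}\cdot\frac{s_1^2\,\|f^*\|_{P_{\mathcal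 X}}^2}{(1-\epsilon)^2}.$$ -/

import Mathlib

open MeasureTheory

open scoped ENNReal

noncomputable section

namespace Contexture

variable {X A : Type*} [MeasurableSpace X] [MeasurableSpace A]

/-- The density `P⁺(x,a) / (P_X(x) P_A(a))` of a joint law `P` on `X × A` with respect to the
product `P_X ⊗ P_A` of its marginals; it equals `P⁺(a|x) / P_A(a)`. -/
def jointDensity (P : Measure (X × A)) (x : X) (a : A) : ℝ≥0∞ :=
  P.rnDeriv (P.fst.prod P.snd) (x, a)

/-- The dual kernel `k_X⁺(x,x') = ∫ P⁺(a|x) P⁺(a|x') / P_A(a) da` of the context `P`. -/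
def dualKernel (P : Measure (X × A)) (x x' : X) : ℝ :=
  ∫ a, (jointDensity P x a).toReal * (jointDensity P x' a).toReal ∂P.snd

/-- The context complexity `κ`: `κ²` is the `P_X`-essential supremum of
`k_X⁺(x,x) = D_χ²(P⁺(·|x) ‖ P_A) + 1`, computed in `[0,∞]` so that no integrability is needed. -/
def contextComplexity (P : Measure (X × A)) : ℝ≥0∞ :=
  (essSup (fun x => ∫⁻ a, jointDensity P x a ^ 2 ∂P.snd) P.fst) ^ (1 / 2 : ℝ)

/-- The centered kernel of `k` with respect to `ν`. -/
def centeredKernel (ν : Measure X) (k : X → X → ℝ) (x x' : X) : ℝ :=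
  k x x' - (∫ z, k z x' ∂ν) - (∫ z', k x z' ∂ν) + ∫ z, ∫ z', k z z' ∂ν ∂ν

/-- The integral operator `T_k`, as an operation on functions. -/
def integralOperator (ν : Measure X) (k : X → X → ℝ) (f : X → ℝ) (x : X) : ℝ :=
  ∫ x', f x' * k x x' ∂ν

/-- `f ∈ L²(ν)` satisfies `T_k f = c f` in `L²(ν)`. -/
def IsEigenfunction (ν : Measure X) (k : X → X → ℝ) (c : ℝ) (f : Lp ℝ 2 ν) : Prop :=
  integralOperator ν k f =ᵐ[ν] fun x => c * f x

/-- `s 0 ≥ s 1 ≥ ⋯ ≥ 0` and `μ 0, μ 1, …` list the eigenvalues `(s i)²` of `T_k`, with multiplicity,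
and corresponding orthonormal eigenfunctions. Indices start at `0`, so `s i` is the `(i+1)`-st value.
If `T_k` has finite rank the list of nonzero eigenvalues is continued by zeros, and nothing
is asked of `μ i` where `s i = 0`. -/
structure IsEigensystem (ν : Measure X) (k : X → X → ℝ) (s : ℕ → ℝ) (μ : ℕ → Lp ℝ 2 ν) :
    Prop where
  nonneg : ∀ i, 0 ≤ s i
  antitone : Antitone s
  orthonormal : Orthonormal ℝ fun i : {i : ℕ // s i ≠ 0} => μ i
  eigen : ∀ i, s i ≠ 0 → IsEigenfunction ν k (s i ^ 2) (μ i)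
  /-- no eigenfunction of a nonzero eigenvalue is left out -/
  exhaustive : ∀ (c : ℝ) (f : Lp ℝ 2 ν), c ≠ 0 → IsEigenfunction ν k c f →
    (∀ i, s i ≠ 0 → inner ℝ (μ i) f = 0) → f = 0

/-- The induced RKHS `H_k = {∑ sᵢ uᵢ μᵢ : ∑ uᵢ² < ∞} ⊆ L²(ν)`. -/
def inducedRKHS {ν : Measure X} (s : ℕ → ℝ) (μ : ℕ → Lp ℝ 2 ν) : Set (Lp ℝ 2 ν) :=
  {f | ∃ u : ℕ → ℝ, Summable (fun i => u i ^ 2) ∧ HasSum (fun i => (s i * u i) • μ i) f}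

/-- The inner product `⟨∑ uᵢ μᵢ, ∑ vᵢ μᵢ⟩ = ∑ uᵢ vᵢ / sᵢ²` of `H_k`; terms with `sᵢ = 0` are `0`. -/
def hkInner {ν : Measure X} (s : ℕ → ℝ) (μ : ℕ → Lp ℝ 2 ν) (f g : Lp ℝ 2 ν) : ℝ :=
  ∑' i, inner ℝ (μ i) f * inner ℝ (μ i) g / s i ^ 2

/-- The norm of `H_k`. -/
def hkNorm {ν : Measure X} (s : ℕ → ℝ) (μ : ℕ → Lp ℝ 2 ν) (f : Lp ℝ 2 ν) : ℝ :=
  Real.sqrt (hkInner s μ f f)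

/-- The centered version `f - 𝔼 f` of `f`. -/
def centered {ν : Measure X} [IsProbabilityMeasure ν] (f : Lp ℝ 2 ν) : Lp ℝ 2 ν :=
  f - (memLp_const (∫ x, f x ∂ν)).toLp (fun _ : X => ∫ x, f x ∂ν)

/-- The functions that are `(1-ε)`-compatible with `H_k`. -/
def compatibleClass {ν : Measure X} [IsProbabilityMeasure ν] (s : ℕ → ℝ) (μ : ℕ → Lp ℝ 2 ν)
    (ε : ℝ) : Set (Lp ℝ 2 ν) :=
  {f | f ∈ inducedRKHS s μ ∧ ‖centered f‖ ≤ hkNorm s μ (centered f) ∧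
    (1 - ε) * hkNorm s μ (centered f) ≤ ‖centered f‖}

/-- The Gram matrix `G[i,j] = k(xᵢ, xⱼ)`. -/
def gramMatrix {m : ℕ} (k : X → X → ℝ) (x : Fin m → X) : Matrix (Fin m) (Fin m) ℝ :=
  Matrix.of fun i j => k (x i) (x j)

/-- `lam` lists the eigenvalues of `G` in nonincreasing order, with orthonormal eigenvectors `v`. -/
structure IsEigendecomposition {m : ℕ} (G : Matrix (Fin m) (Fin m) ℝ) (lam : Fin m → ℝ)
    (v : Fin m → EuclideanSpace ℝ (Fin m)) : Prop where
  antitone : Antitone lam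
  orthonormal : Orthonormal ℝ v
  eigen : ∀ i, G.mulVec (v i).ofLp = lam i • (v i).ofLp

/-- The empirical top-`d` eigenfunctions `φᵢ(y) = λᵢ^{-1/2} ∑ⱼ vᵢ[j] k(y, xⱼ)` of kernel PCA. -/
def kpcaEncoder {m d : ℕ} (hdm : d ≤ m) (k : X → X → ℝ) (x : Fin m → X) (lam : Fin m → ℝ)
    (v : Fin m → EuclideanSpace ℝ (Fin m)) (i : Fin d) (y : X) : ℝ :=
  (1 / Real.sqrt (lam (Fin.castLE hdm i))) * ∑ j, v (Fin.castLE hdm i) j * k y (x j)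

/-- The span of `Φ = [φ₁, …, φ_d]`, as a set of elements of `L²(ν)`. -/
def encoderSpan {ν : Measure X} {d : ℕ} (Φ : Fin d → X → ℝ) : Set (Lp ℝ 2 ν) :=
  {g | ∃ w : Fin d → ℝ, g =ᵐ[ν] fun y => ∑ i, w i * Φ i y}

/-- `g` is the `H_k`-orthogonal projection of `f` onto the span of `Φ`. -/
def IsHkProjection {ν : Measure X} {d : ℕ} (s : ℕ → ℝ) (μ : ℕ → Lp ℝ 2 ν) (Φ : Fin d → X → ℝ)
    (f g : Lp ℝ 2 ν) : Prop :=
  g ∈ encoderSpan Φ ∧ ∀ h ∈ encoderSpan Φ, hkInner s μ (f - g) h = 0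

/-- The deviation term `κ² (2 √d + 3 √(log (6/δ))) / √m`. -/
def deviation (κ : ℝ) (d m : ℕ) (δ : ℝ) : ℝ :=
  κ ^ 2 / Real.sqrt m * (2 * Real.sqrt d + 3 * Real.sqrt (Real.log (6 / δ)))

end Contexture

end

/-! The centered features `φ(x) = r(x,·) - 1` in `L²(P_A)` satisfy `‖φ(x)‖ ≤ κ` and `k(x,y) = ⟨φ(x),
φ(y)⟩` at almost all points. The operator `D g = ⟨φ(·), g⟩` is Hilbert–Schmidt and `T_k = D D†`, so
its singular value decomposition replaces `φ` by features `C` in `ℓ²` with the same inner products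
almost everywhere (`exists_feature_representation`). The map `F p = ∑ sᵢ pᵢ μᵢ = ⟨C(·), p⟩` is then
an isometry of `ℓ²` onto `H_k`. The encoder functions are the images `F pᵢ` of the orthonormal
empirical eigenvectors, and the projection of `F u` is `F u₁`, with `u₁` the `ℓ²`-projection of `u`
onto their span.

The compatibility of `F u` says `‖F u‖ ≥ (1-ε)‖u‖`. If `F` has square norm at most `s_{d+1}² + η` on
the complement of the `pᵢ`, then `u` cannot have a large component there
(`norm_sq_orthogonal_part_le`). That norm bound follows from Ky Fan's principle applied to the `pᵢ`
and one more unit vector, once `∑ ‖F pᵢ‖²` is within `η` of the sum of the top `d` eigenvalues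
(`norm_sq_image_le_of_orthogonal`).

The last fact is probabilistic (`exists_measurableSet_excess_le`). Captured energy is a linear
functional of the covariance tensor, given by a projector. The `pᵢ` maximize the empirical energy,
so their population deficit is at most the supremum, over all projectors, of a deviation of an
empirical mean. Cauchy–Schwarz bounds the expectation of this supremum, and McDiarmid's inequality
its fluctuation. -/

noncomputable section

namespace Contexture

/-! ### McDiarmid's inequality for i.i.d. samples -/

section Concentration

variable {X : Type*} [MeasurableSpace X]

lemma measurable_finCons (n : ℕ) :
    Measurable (fun p : X × (Fin n → X) => (Fin.cons p.1 p.2 : Fin (n + 1) → X)) := by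
  refine measurable_pi_lambda _ fun i => ?_
  refine Fin.cases ?_ (fun j => ?_) i
  · simpa using measurable_fst
  · simpa [Function.comp_def] using (measurable_pi_apply j).comp measurable_snd

lemma measurePreserving_finCons (ν : Measure X) [IsProbabilityMeasure ν] (n : ℕ) :
    MeasurePreserving (fun p : X × (Fin n → X) => (Fin.cons p.1 p.2 : Fin (n + 1) → X))
      (ν.prod (Measure.pi fun _ => ν)) (Measure.pi fun _ => ν) := by
  have h := (measurePreserving_piFinSuccAbove (fun _ : Fin (n + 1) => ν) 0).symm
  convert h using 1
  ext p i
  simp [MeasurableEquiv.piFinSuccAbove_symm_apply, Fin.insertNthEquiv]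

lemma integral_pi_succ (ν : Measure X) [IsProbabilityMeasure ν] {n : ℕ}
    {f : (Fin (n + 1) → X) → ℝ} (hf : Integrable f (Measure.pi fun _ => ν)) :
    ∫ x, f x ∂(Measure.pi fun _ => ν) =
      ∫ y, ∫ x, f (Fin.cons y x) ∂(Measure.pi fun _ : Fin n => ν) ∂ν := by
  have h := measurePreserving_finCons ν n
  have hf' : AEStronglyMeasurable f ((ν.prod (Measure.pi fun _ => ν)).map
      (fun p : X × (Fin n → X) => (Fin.cons p.1 p.2 : Fin (n + 1) → X))) := by
    rw [h.map_eq]; exact hf.1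
  have h1 := integral_map h.measurable.aemeasurable hf'
  rw [h.map_eq] at h1
  rw [h1]
  exact integral_prod _ (h.integrable_comp_of_integrable hf)

/-- Hoeffding's lemma: bounded oscillation puts `G` in an interval of length `c` that starts at its
infimum. -/
lemma integral_exp_sub_integral_le_of_osc (ν : Measure X) [IsProbabilityMeasure ν] {c : ℝ}
    {G : X → ℝ} (hG : Measurable G) (hc : ∀ x y, G x - G y ≤ c) (t : ℝ) :
    ∫ x, Real.exp (t * (G x - ∫ y, G y ∂ν)) ∂ν ≤ Real.exp (c ^ 2 * t ^ 2 / 8) := by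
  have hne : Nonempty X := nonempty_of_isProbabilityMeasure ν
  have x₀ := hne.some
  have hbdd : BddBelow (Set.range G) := ⟨G x₀ - c, by
    rintro _ ⟨y, rfl⟩; linarith [hc x₀ y]⟩
  have hmem : ∀ x, G x ∈ Set.Icc (⨅ y, G y) ((⨅ y, G y) + c) := fun x =>
    ⟨ciInf_le hbdd x, by
      have : G x - c ≤ ⨅ y, G y := le_ciInf fun y => by linarith [hc x y]
      linarith⟩
  have h := (ProbabilityTheory.hasSubgaussianMGF_of_mem_Icc (μ := ν) hG.aemeasurable
    (Filter.Eventually.of_forall hmem)).mgf_le t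
  refine h.trans_eq ?_
  congr 1
  push_cast
  rw [add_sub_cancel_left, div_pow, Real.norm_eq_abs, sq_abs]
  ring

/-- The McDiarmid bound on the moment generating function of a function of independent samples with
bounded differences. -/
theorem integral_exp_sub_integral_le_of_bounded_differences (ν : Measure X)
    [IsProbabilityMeasure ν] {c : ℝ} (t : ℝ) (n : ℕ) (g : (Fin n → X) → ℝ) (hg : Measurable g)
    (hb : ∃ M, ∀ x, |g x| ≤ M) (hd : ∀ x i y, g (Function.update x i y) - g x ≤ c) :
    ∫ x, Real.exp (t * (g x - ∫ y, g y ∂(Measure.pi fun _ => ν))) ∂(Measure.pi fun _ => ν) ≤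
      Real.exp (n * c ^ 2 * t ^ 2 / 8) := by
  induction n with
  | zero =>
    have hg0 : g = fun _ => g Fin.elim0 := funext fun x => congrArg g (Subsingleton.elim _ _)
    rw [hg0]
    simp
  | succ n ih =>
    obtain ⟨M, hM⟩ := hb
    set ρ := Measure.pi fun _ : Fin n => ν with hρ
    set ρ' := Measure.pi fun _ : Fin (n + 1) => ν with hρ'
    have hgc : ∀ y, Measurable fun x : Fin n → X => g (Fin.cons y x) := fun y =>
      hg.comp ((measurable_finCons n).comp measurable_prodMk_left)
    have hgi : ∀ y, Integrable (fun x : Fin n → X => g (Fin.cons y x)) ρ := fun y =>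
      Integrable.of_bound (hgc y).aestronglyMeasurable M (Filter.Eventually.of_forall fun x => hM _)
    have hgi' : Integrable g ρ' :=
      Integrable.of_bound hg.aestronglyMeasurable M (Filter.Eventually.of_forall fun x => hM _)
    -- The conditional mean given the first sample. Averaging preserves the oscillation bound, so
    -- Hoeffding's lemma handles `G` and the induction hypothesis handles `g` around `G`.
    set G : X → ℝ := fun y => ∫ x, g (Fin.cons y x) ∂ρ with hGdef
    have hGm : Measurable G := by
      have : StronglyMeasurable (fun p : X × (Fin n → X) => g (Fin.cons p.1 p.2)) :=
        (hg.comp (measurable_finCons n)).stronglyMeasurable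
      exact this.integral_prod_right.measurable
    have hGb : ∀ y, |G y| ≤ M := fun y => by
      have := norm_integral_le_of_norm_le_const (μ := ρ)
        (f := fun x => g (Fin.cons y x)) (Filter.Eventually.of_forall fun x => hM (Fin.cons y x))
      simpa using this
    have hI : ∫ x, g x ∂ρ' = ∫ y, G y ∂ν := integral_pi_succ ν hgi'
    have hosc : ∀ x y, G x - G y ≤ c := fun y y' => by
      rw [hGdef]
      simp only
      rw [← integral_sub (hgi y) (hgi y')]
      have : ∀ x : Fin n → X, g (Fin.cons y x) - g (Fin.cons y' x) ≤ c := fun x => by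
        have := hd (Fin.cons y' x) 0 y
        rwa [Fin.update_cons_zero] at this
      calc _ ≤ ∫ x : Fin n → X, c ∂ρ :=
            integral_mono ((hgi y).sub (hgi y')) (integrable_const _) this
        _ = c := by simp
    rw [hI]
    set I := ∫ y, G y ∂ν
    have hIb : |I| ≤ M := by
      have := norm_integral_le_of_norm_le_const (μ := ν) (f := G)
        (Filter.Eventually.of_forall hGb)
      simpa using this
    have hexp : ∀ a : ℝ, ∀ b, |a| ≤ M → |b| ≤ M → Real.exp (t * (a - b)) ≤
        Real.exp (|t| * (2 * M)) := fun a b ha hb => by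
      apply Real.exp_le_exp.2
      calc t * (a - b) ≤ |t * (a - b)| := le_abs_self _
        _ = |t| * |a - b| := abs_mul _ _
        _ ≤ |t| * (2 * M) := by
          gcongr
          calc |a - b| ≤ |a| + |b| := abs_sub _ _
            _ ≤ 2 * M := by linarith
    have hEi : Integrable (fun x => Real.exp (t * (g x - I))) ρ' := by
      refine Integrable.of_bound ((hg.sub_const _).const_mul t).exp.aestronglyMeasurable
        (Real.exp (|t| * (2 * M))) (Filter.Eventually.of_forall fun x => ?_)
      rw [Real.norm_eq_abs, Real.abs_exp]
      exact hexp _ _ (hM x) hIb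
    rw [integral_pi_succ ν hEi]
    have hstep : ∀ y, ∫ x, Real.exp (t * (g (Fin.cons y x) - I)) ∂ρ ≤
        Real.exp (n * c ^ 2 * t ^ 2 / 8) * Real.exp (t * (G y - I)) := fun y => by
      have h1 := ih (fun x => g (Fin.cons y x)) (hgc y) ⟨M, fun x => hM _⟩ (fun x i z => by
        have := hd (Fin.cons y x) i.succ z
        rwa [← Fin.cons_update] at this)
      calc ∫ x, Real.exp (t * (g (Fin.cons y x) - I)) ∂ρ
          = ∫ x, Real.exp (t * (g (Fin.cons y x) - G y)) * Real.exp (t * (G y - I)) ∂ρ := by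
            congr 1; ext x; rw [← Real.exp_add]; congr 1; ring
        _ = (∫ x, Real.exp (t * (g (Fin.cons y x) - G y)) ∂ρ) * Real.exp (t * (G y - I)) :=
            integral_mul_const _ _
        _ ≤ _ := by gcongr
    have hGe : Integrable (fun y => Real.exp (t * (G y - I))) ν := by
      refine Integrable.of_bound ((hGm.sub_const _).const_mul t).exp.aestronglyMeasurable
        (Real.exp (|t| * (2 * M))) (Filter.Eventually.of_forall fun x => ?_)
      rw [Real.norm_eq_abs, Real.abs_exp]
      exact hexp _ _ (hGb x) hIb
    calc ∫ y, ∫ x, Real.exp (t * (g (Fin.cons y x) - I)) ∂ρ ∂ν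
        ≤ ∫ y, Real.exp (n * c ^ 2 * t ^ 2 / 8) * Real.exp (t * (G y - I)) ∂ν := by
          refine integral_mono_of_nonneg (Filter.Eventually.of_forall fun y =>
            integral_nonneg fun x => (Real.exp_pos _).le) (hGe.const_mul _)
            (Filter.Eventually.of_forall hstep)
      _ = Real.exp (n * c ^ 2 * t ^ 2 / 8) * ∫ y, Real.exp (t * (G y - I)) ∂ν :=
          integral_const_mul _ _
      _ ≤ Real.exp (n * c ^ 2 * t ^ 2 / 8) * Real.exp (c ^ 2 * t ^ 2 / 8) := by
          gcongr
          exact integral_exp_sub_integral_le_of_osc ν hGm hosc t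
      _ = _ := by
          rw [← Real.exp_add]; congr 1; push_cast; ring

/-- The McDiarmid inequality. -/
theorem measure_bounded_differences_ge_le (ν : Measure X) [IsProbabilityMeasure ν] {c : ℝ}
    {n : ℕ} (g : (Fin n → X) → ℝ) (hg : Measurable g) (hb : ∃ M, ∀ x, |g x| ≤ M)
    (hd : ∀ x i y, g (Function.update x i y) - g x ≤ c) {E a : ℝ}
    (hE : ∫ x, g x ∂(Measure.pi fun _ => ν) ≤ E) (hn : 0 < n) (hc : 0 < c) (ha : 0 ≤ a) :
    (Measure.pi fun _ : Fin n => ν).real {x | E + a ≤ g x} ≤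
      Real.exp (-(2 * a ^ 2 / (n * c ^ 2))) := by
  obtain ⟨M, hM⟩ := hb
  set ρ := Measure.pi fun _ : Fin n => ν
  set I := ∫ x, g x ∂ρ
  have hn' : (0 : ℝ) < n := by exact_mod_cast hn
  -- The minimizer of the Chernoff exponent `-t a + n c² t² / 8`.
  set t : ℝ := 4 * a / (n * c ^ 2) with ht
  have ht0 : 0 ≤ t := by positivity
  have hInt : Integrable (fun x => Real.exp (t * (g x - I))) ρ := by
    refine Integrable.of_bound ((hg.sub_const _).const_mul t).exp.aestronglyMeasurable
      (Real.exp (|t| * (M + |I|))) (Filter.Eventually.of_forall fun x => ?_)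
    rw [Real.norm_eq_abs, Real.abs_exp]
    apply Real.exp_le_exp.2
    calc t * (g x - I) ≤ |t * (g x - I)| := le_abs_self _
      _ = |t| * |g x - I| := abs_mul _ _
      _ ≤ |t| * (M + |I|) := by
        gcongr
        exact (abs_sub _ _).trans (by linarith [hM x])
  have hch := ProbabilityTheory.measure_ge_le_exp_mul_mgf (μ := ρ) (X := fun x => g x - I) a ht0
    hInt
  have hmgf := integral_exp_sub_integral_le_of_bounded_differences ν t n g hg ⟨M, hM⟩ hd
  calc ρ.real {x | E + a ≤ g x} ≤ ρ.real {x | a ≤ g x - I} := by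
        apply measureReal_mono _ (measure_ne_top _ _)
        intro x hx
        simp only [Set.mem_ofPred_eq] at hx ⊢
        linarith
    _ ≤ Real.exp (-t * a) * ProbabilityTheory.mgf (fun x => g x - I) ρ t := hch
    _ ≤ Real.exp (-t * a) * Real.exp (n * c ^ 2 * t ^ 2 / 8) := by
        gcongr
        exact hmgf
    _ = _ := by
        rw [← Real.exp_add]
        congr 1
        rw [ht]
        field_simp
        ring

end Concentration

/-! ### Empirical means of bounded Hilbert space valued variables -/

section Hilbert

variable {X : Type*} [MeasurableSpace X] {𝓗 : Type*} [NormedAddCommGroup 𝓗]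
  [InnerProductSpace ℝ 𝓗] [CompleteSpace 𝓗]

/-- The cross term with `v` vanishes because `Y - 𝔼 Y` has mean zero, and a variance is at most the
second moment. -/
lemma integral_norm_add_sub_integral_sq_le (ν : Measure X) [IsProbabilityMeasure ν] {Y : X → 𝓗}
    (hY : StronglyMeasurable Y) {K : ℝ} (hK : ∀ x, ‖Y x‖ ≤ K) (v : 𝓗) :
    ∫ x, ‖v + (Y x - ∫ y, Y y ∂ν)‖ ^ 2 ∂ν ≤ ‖v‖ ^ 2 + K ^ 2 := by
  have hYi : Integrable Y ν :=
    Integrable.of_bound hY.aestronglyMeasurable K (Filter.Eventually.of_forall hK)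
  set y₀ := ∫ y, Y y ∂ν
  have hK0 : 0 ≤ K := (norm_nonneg _).trans
    (hK (nonempty_of_isProbabilityMeasure ν).some)
  have hsq : Integrable (fun x => ‖Y x‖ ^ 2) ν := by
    refine Integrable.of_bound (hY.norm.pow 2).aestronglyMeasurable (K ^ 2)
      (Filter.Eventually.of_forall fun x => ?_)
    rw [Real.norm_eq_abs, abs_of_nonneg (by positivity)]
    have := hK x
    gcongr
  have hexp : ∀ x, ‖v + (Y x - y₀)‖ ^ 2 =
      ‖v - y₀‖ ^ 2 + 2 * inner ℝ (v - y₀) (Y x) + ‖Y x‖ ^ 2 := fun x => by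
    rw [← norm_add_sq_real]; congr 2; abel
  simp_rw [hexp]
  have hin : Integrable (fun x => inner ℝ (v - y₀) (Y x)) ν := hYi.const_inner _
  rw [integral_add (Integrable.fun_add (integrable_const _) (hin.const_mul 2)) hsq,
    integral_add (integrable_const _) (hin.const_mul 2), integral_const_mul, integral_inner hYi]
  have h2 : ∫ x, ‖Y x‖ ^ 2 ∂ν ≤ K ^ 2 := by
    calc _ ≤ ∫ x, K ^ 2 ∂ν := by
          refine integral_mono hsq (integrable_const _) fun x => ?_
          have := hK x
          dsimp only
          gcongr
      _ = K ^ 2 := by simp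
  have h3 : ‖v - y₀‖ ^ 2 + 2 * inner ℝ (v - y₀) y₀ = ‖v‖ ^ 2 - ‖y₀‖ ^ 2 := by
    rw [norm_sub_sq_real, inner_sub_left, real_inner_self_eq_norm_sq]; ring
  simp only [integral_const, probReal_univ, one_smul]
  have := sq_nonneg ‖y₀‖
  change ‖v - y₀‖ ^ 2 + 2 * inner ℝ (v - y₀) y₀ + _ ≤ _
  linarith

/-- Orthogonality of independent centered summands, by induction: the offset `v` absorbs the sample
already peeled off. -/
lemma integral_norm_add_sum_sub_integral_sq_le (ν : Measure X) [IsProbabilityMeasure ν]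
    {Y : X → 𝓗} (hY : StronglyMeasurable Y) {K : ℝ} (hK : ∀ x, ‖Y x‖ ≤ K) (n : ℕ) (v : 𝓗) :
    ∫ x, ‖v + ∑ j, (Y (x j) - ∫ y, Y y ∂ν)‖ ^ 2 ∂(Measure.pi fun _ : Fin n => ν) ≤
      ‖v‖ ^ 2 + n * K ^ 2 := by
  set y₀ := ∫ y, Y y ∂ν with hy₀
  have hK0 : 0 ≤ K := (norm_nonneg _).trans
    (hK (nonempty_of_isProbabilityMeasure ν).some)
  have hmeas : ∀ n : ℕ, ∀ v : 𝓗,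
      StronglyMeasurable fun x : Fin n → X => ‖v + ∑ j, (Y (x j) - y₀)‖ ^ 2 := fun n v => by
    refine (StronglyMeasurable.norm (stronglyMeasurable_const.add ?_)).pow 2
    refine Finset.stronglyMeasurable_fun_sum _ fun j _ => ?_
    exact (hY.comp_measurable (measurable_pi_apply j)).sub stronglyMeasurable_const
  have hbd : ∀ n : ℕ, ∀ v : 𝓗, ∀ x : Fin n → X,
      ‖v + ∑ j, (Y (x j) - y₀)‖ ≤ ‖v‖ + n * (K + ‖y₀‖) := fun n v x => by
    refine (norm_add_le _ _).trans ?_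
    gcongr
    refine (norm_sum_le _ _).trans ?_
    calc _ ≤ ∑ _j : Fin n, (K + ‖y₀‖) :=
          Finset.sum_le_sum fun j _ => (norm_sub_le _ _).trans (by gcongr; exact hK _)
      _ = _ := by simp [mul_add]
  have hInt : ∀ n : ℕ, ∀ v : 𝓗, Integrable (fun x : Fin n → X =>
      ‖v + ∑ j, (Y (x j) - y₀)‖ ^ 2) (Measure.pi fun _ => ν) := fun n v => by
    refine Integrable.of_bound (hmeas n v).aestronglyMeasurable ((‖v‖ + n * (K + ‖y₀‖)) ^ 2)
      (Filter.Eventually.of_forall fun x => ?_)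
    rw [Real.norm_eq_abs, abs_of_nonneg (by positivity)]
    have := hbd n v x
    gcongr
  induction n generalizing v with
  | zero => simp
  | succ n ih =>
    rw [integral_pi_succ ν (hInt (n + 1) v)]
    simp only [Fin.sum_univ_succ, Fin.cons_zero, Fin.cons_succ, ← add_assoc]
    have hb1 : Integrable (fun y => ‖v + (Y y - y₀)‖ ^ 2) ν := by
      refine Integrable.of_bound (C := (‖v‖ + (K + ‖y₀‖)) ^ 2)
        ((stronglyMeasurable_const.add (hY.sub stronglyMeasurable_const)).norm.pow
          2).aestronglyMeasurable (Filter.Eventually.of_forall fun y => ?_)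
      rw [Real.norm_eq_abs, abs_of_nonneg (by positivity)]
      have : ‖v + (Y y - y₀)‖ ≤ ‖v‖ + (K + ‖y₀‖) :=
        (norm_add_le _ _).trans (by
          gcongr; exact (norm_sub_le _ _).trans (by gcongr; exact hK _))
      gcongr
    have hb2 := Integrable.fun_add hb1 (integrable_const (n * K ^ 2))
    calc _ ≤ ∫ y, (‖v + (Y y - y₀)‖ ^ 2 + n * K ^ 2) ∂ν := by
          refine integral_mono_of_nonneg (Filter.Eventually.of_forall fun y =>
            integral_nonneg fun x => by positivity) hb2
            (Filter.Eventually.of_forall fun y => ih (v + (Y y - y₀)))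
      _ ≤ ‖v‖ ^ 2 + K ^ 2 + n * K ^ 2 := by
          rw [integral_add hb1 (integrable_const _)]
          have := integral_norm_add_sub_integral_sq_le ν hY hK v
          simp only [integral_const, probReal_univ, one_smul]
          linarith
      _ = _ := by push_cast; ring

/-- The empirical mean of `n` independent copies of a bounded Hilbert space valued variable. -/
def empiricalMean {n : ℕ} (Y : X → 𝓗) (x : Fin n → X) : 𝓗 := (n : ℝ)⁻¹ • ∑ j, Y (x j)

lemma integral_norm_empiricalMean_sub_le (ν : Measure X) [IsProbabilityMeasure ν]
    {Y : X → 𝓗} (hY : StronglyMeasurable Y) {K : ℝ} (hK : ∀ x, ‖Y x‖ ≤ K) {n : ℕ} (hn : 0 < n) :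
    ∫ x : Fin n → X, ‖empiricalMean Y x - ∫ y, Y y ∂ν‖ ∂(Measure.pi fun _ => ν) ≤
      K / Real.sqrt n := by
  have h := integral_norm_add_sum_sub_integral_sq_le ν hY hK n 0
  set y₀ := ∫ y, Y y ∂ν with hy₀
  have hn' : (0 : ℝ) < n := by exact_mod_cast hn
  have hK0 : 0 ≤ K := (norm_nonneg _).trans
    (hK (nonempty_of_isProbabilityMeasure ν).some)
  have heq : ∀ x : Fin n → X, ‖∑ j, (Y (x j) - y₀)‖ = n * ‖empiricalMean Y x - y₀‖ := fun x => by
    have : ∑ j, (Y (x j) - y₀) = (n : ℝ) • (empiricalMean Y x - y₀) := by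
      rw [smul_sub, empiricalMean, smul_smul, mul_inv_cancel₀ hn'.ne', one_smul,
        Finset.sum_sub_distrib]
      simp [← Nat.cast_smul_eq_nsmul ℝ]
    rw [this, norm_smul]; simp
  simp only [zero_add, norm_zero, heq] at h
  have hm : StronglyMeasurable fun x : Fin n → X => ‖empiricalMean Y x - y₀‖ := by
    refine (StronglyMeasurable.sub ?_ stronglyMeasurable_const).norm
    refine StronglyMeasurable.const_smul ?_ _
    exact Finset.stronglyMeasurable_fun_sum _ fun j _ =>
      hY.comp_measurable (measurable_pi_apply j)
  set ρ := Measure.pi fun _ : Fin n => ν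
  have hbd : ∀ x : Fin n → X, ‖empiricalMean Y x - y₀‖ ≤ K + ‖y₀‖ := fun x => by
    refine (norm_sub_le _ _).trans ?_
    gcongr
    rw [empiricalMean, norm_smul, norm_inv, Real.norm_natCast, inv_mul_le_iff₀ hn']
    refine (norm_sum_le _ _).trans ((Finset.sum_le_sum fun j _ => hK _).trans ?_)
    simp
  have hL2 : MemLp (fun x : Fin n → X => ‖empiricalMean Y x - y₀‖) 2 ρ :=
    MemLp.of_bound hm.aestronglyMeasurable (K + ‖y₀‖)
      (Filter.Eventually.of_forall fun x => by simpa using hbd x)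
  -- Nonnegativity of the variance gives the first moment from the second.
  have hvar := ProbabilityTheory.variance_eq_sub hL2
  have hvar0 := ProbabilityTheory.variance_nonneg (fun x : Fin n → X => ‖empiricalMean Y x - y₀‖) ρ
  simp_rw [mul_pow] at h
  rw [integral_const_mul] at h
  have h2 : ∫ x, ‖empiricalMean Y x - y₀‖ ^ 2 ∂ρ ≤ K ^ 2 / n := by
    rw [le_div_iff₀ hn']
    have : (n : ℝ) * ((∫ x, ‖empiricalMean Y x - y₀‖ ^ 2 ∂ρ) * n) ≤ n * K ^ 2 := by
      nlinarith
    exact le_of_mul_le_mul_left this hn'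
  have h3 : (∫ x, ‖empiricalMean Y x - y₀‖ ∂ρ) ^ 2 ≤ (K / Real.sqrt n) ^ 2 := by
    rw [div_pow, Real.sq_sqrt hn'.le]
    simp only [Pi.pow_apply] at hvar
    linarith
  exact le_of_sq_le_sq h3 (by positivity)

/-- A uniform deviation bound for linear functionals of the empirical mean of a bounded variable
with values in a Hilbert space. -/
theorem exists_measurableSet_forall_inner_empiricalMean_le (ν : Measure X)
    [IsProbabilityMeasure ν] {Y : X → 𝓗} (hY : StronglyMeasurable Y) {K : ℝ}
    (hK : ∀ x, ‖Y x‖ ≤ K) {n : ℕ} (hn : 0 < n) {I : Type*} (B : I → 𝓗) {b c : ℝ}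
    (hB : ∀ i, ‖B i‖ ≤ b) (hc : 0 < c)
    (hosc : ∀ i x y, inner ℝ (B i) (Y x) - inner ℝ (B i) (Y y) ≤ c)
    {δ : ℝ} (hδ0 : 0 < δ) (hδ1 : δ < 1) :
    ∃ S : Set (Fin n → X), MeasurableSet S ∧
      ENNReal.ofReal (1 - δ) ≤ Measure.pi (fun _ : Fin n => ν) S ∧
      ∀ x ∈ S, ∀ i, inner ℝ (B i) (empiricalMean Y x - ∫ y, Y y ∂ν) ≤
        b * (K / Real.sqrt n) + c * Real.sqrt (Real.log (1 / δ) / (2 * n)) := by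
  rcases isEmpty_or_nonempty I with hI | hI
  · exact ⟨Set.univ, .univ, by simpa using hδ0.le, fun x _ i => hI.elim i⟩
  have hn' : (0 : ℝ) < n := by exact_mod_cast hn
  have hX := nonempty_of_isProbabilityMeasure ν
  have hb0 : 0 ≤ b := (norm_nonneg _).trans (hB hI.some)
  have hK0 : 0 ≤ K := (norm_nonneg _).trans (hK hX.some)
  set y₀ := ∫ y, Y y ∂ν with hy₀
  set ρ := Measure.pi fun _ : Fin n => ν with hρ
  -- The index set may be uncountable; the supremum is still measurable in the samples because it is
  -- Lipschitz in `y`.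
  set Ψ : 𝓗 → ℝ := fun y => ⨆ i, inner ℝ (B i) y with hΨ
  have hin : ∀ i y, inner ℝ (B i) y ≤ b * ‖y‖ := fun i y =>
    (real_inner_le_norm _ _).trans (by gcongr; exact hB i)
  have hbdd : ∀ y, BddAbove (Set.range fun i => inner ℝ (B i) y) := fun y =>
    ⟨b * ‖y‖, by rintro _ ⟨i, rfl⟩; exact hin i y⟩
  have hle : ∀ i y, inner ℝ (B i) y ≤ Ψ y := fun i y => le_ciSup (hbdd y) i
  have hΨle : ∀ y, Ψ y ≤ b * ‖y‖ := fun y => ciSup_le fun i => hin i y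
  have hΨlip : ∀ y z, Ψ y - Ψ z ≤ b * ‖y - z‖ := fun y z => by
    rw [sub_le_iff_le_add']
    refine ciSup_le fun i => ?_
    have h1 : inner ℝ (B i) y = inner ℝ (B i) z + inner ℝ (B i) (y - z) := by
      rw [inner_sub_right]; ring
    rw [h1]
    exact add_le_add (hle i z) (hin i _)
  have hΨc : Continuous Ψ := by
    have : LipschitzWith b.toNNReal Ψ := LipschitzWith.of_le_add_mul _ fun y z => by
      rw [Real.coe_toNNReal _ hb0, dist_eq_norm]
      linarith [hΨlip y z]
    exact this.continuous
  have hmean : StronglyMeasurable fun x : Fin n → X => empiricalMean Y x - y₀ := by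
    refine StronglyMeasurable.sub ?_ stronglyMeasurable_const
    refine StronglyMeasurable.const_smul ?_ _
    exact Finset.stronglyMeasurable_fun_sum _ fun j _ =>
      hY.comp_measurable (measurable_pi_apply j)
  set g : (Fin n → X) → ℝ := fun x => Ψ (empiricalMean Y x - y₀) with hgdef
  have hg : Measurable g := (hΨc.comp_stronglyMeasurable hmean).measurable
  have hbd : ∀ x : Fin n → X, ‖empiricalMean Y x - y₀‖ ≤ K + ‖y₀‖ := fun x => by
    refine (norm_sub_le _ _).trans ?_
    gcongr
    rw [empiricalMean, norm_smul, norm_inv, Real.norm_natCast, inv_mul_le_iff₀ hn']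
    refine (norm_sum_le _ _).trans ((Finset.sum_le_sum fun j _ => hK _).trans ?_)
    simp
  have hgb : ∀ x, |g x| ≤ b * (K + ‖y₀‖) := fun x => by
    have h1 : |g x| ≤ b * ‖empiricalMean Y x - y₀‖ := by
      refine abs_le.2 ⟨?_, hΨle _⟩
      refine le_trans ?_ (hle hI.some _)
      have := (abs_real_inner_le_norm (B hI.some) (empiricalMean Y x - y₀)).trans
        (mul_le_mul_of_nonneg_right (hB hI.some) (norm_nonneg _))
      exact (abs_le.1 this).1
    exact h1.trans (by gcongr; exact hbd x)
  -- Replacing one sample moves the mean by `(Y y - Y (x i)) / n`, which each functional sees as at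
  -- most `c / n`.
  have hgd : ∀ x i y, g (Function.update x i y) - g x ≤ c / n := fun x i y => by
    rw [sub_le_iff_le_add']
    refine ciSup_le fun q => ?_
    have hs : ∑ j, Y (Function.update x i y j) = ∑ j, Y (x j) + (Y y - Y (x i)) := by
      rw [← Finset.add_sum_erase _ _ (Finset.mem_univ i),
        ← Finset.add_sum_erase (a := i) _ (fun j => Y (x j)) (Finset.mem_univ i),
        Function.update_self]
      have : ∑ j ∈ Finset.univ.erase i, Y (Function.update x i y j) =
          ∑ j ∈ Finset.univ.erase i, Y (x j) := Finset.sum_congr rfl fun j hj => by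
        rw [Function.update_of_ne (Finset.ne_of_mem_erase hj)]
      rw [this]; abel
    have h1 : empiricalMean Y (Function.update x i y) - y₀ =
        (empiricalMean Y x - y₀) + (n : ℝ)⁻¹ • (Y y - Y (x i)) := by
      rw [empiricalMean, hs, smul_add, empiricalMean]; abel
    rw [h1, inner_add_right, inner_smul_right, inner_sub_right (B q) (Y y)]
    refine add_le_add (hle q _) ?_
    rw [div_eq_inv_mul]
    gcongr
    exact hosc q y (x i)
  have hE : ∫ x, g x ∂ρ ≤ b * (K / Real.sqrt n) := by
    have hni : Integrable (fun x : Fin n → X => ‖empiricalMean Y x - y₀‖) ρ :=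
      Integrable.of_bound hmean.norm.aestronglyMeasurable (K + ‖y₀‖)
        (Filter.Eventually.of_forall fun x => by simpa using hbd x)
    calc ∫ x, g x ∂ρ ≤ ∫ x, b * ‖empiricalMean Y x - y₀‖ ∂ρ :=
          integral_mono (Integrable.of_bound hg.aestronglyMeasurable (b * (K + ‖y₀‖))
            (Filter.Eventually.of_forall hgb)) (hni.const_mul b) fun x => hΨle _
      _ = b * ∫ x, ‖empiricalMean Y x - y₀‖ ∂ρ := integral_const_mul _ _
      _ ≤ _ := by
        gcongr
        exact integral_norm_empiricalMean_sub_le ν hY hK hn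
  have hlog : 0 < Real.log (1 / δ) := Real.log_pos (by rw [lt_div_iff₀ hδ0]; linarith)
  -- Makes the McDiarmid tail with increments `c / n` equal to `δ`.
  set a := c * Real.sqrt (Real.log (1 / δ) / (2 * n)) with ha
  have hmc := measure_bounded_differences_ge_le ν g hg ⟨_, hgb⟩ hgd hE hn
    (div_pos hc hn') (a := a) (by positivity)
  have hexp : Real.exp (-(2 * a ^ 2 / (n * (c / n) ^ 2))) = δ := by
    have : 2 * a ^ 2 / (n * (c / n) ^ 2) = Real.log (1 / δ) := by
      rw [ha, mul_pow, Real.sq_sqrt (by positivity)]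
      field_simp
    rw [this, one_div, Real.log_inv, neg_neg, Real.exp_log hδ0]
  rw [hexp] at hmc
  have hmS : MeasurableSet {x | b * (K / Real.sqrt n) + a ≤ g x} :=
    measurableSet_le measurable_const hg
  refine ⟨{x | b * (K / Real.sqrt n) + a ≤ g x}ᶜ, hmS.compl, ?_, fun x hx i => ?_⟩
  · rw [← ofReal_measureReal (measure_ne_top _ _)]
    apply ENNReal.ofReal_le_ofReal
    rw [probReal_compl_eq_one_sub hmS]
    linarith
  · simp only [Set.mem_compl_iff, Set.mem_ofPred_eq, not_le] at hx
    exact (hle i _).trans hx.le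

end Hilbert

/-! ### Compactness and completeness of eigenvectors -/

section HilbertSchmidt

variable {E F : Type*} [NormedAddCommGroup E] [InnerProductSpace ℝ E]
  [NormedAddCommGroup F] [InnerProductSpace ℝ F]

/-- Cauchy–Schwarz followed by Bessel; it bounds an operator's tail by its Hilbert–Schmidt norm. -/
lemma norm_sum_smul_le {ι : Type*} {b : ι → E} (hb : Orthonormal ℝ b) (u : ι → F) (x : E)
    (t : Finset ι) :
    ‖∑ i ∈ t, inner ℝ (b i) x • u i‖ ≤ Real.sqrt (∑ i ∈ t, ‖u i‖ ^ 2) * ‖x‖ := by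
  calc ‖∑ i ∈ t, inner ℝ (b i) x • u i‖ ≤ ∑ i ∈ t, ‖u i‖ * ‖inner ℝ (b i) x‖ := by
        refine (norm_sum_le _ _).trans (Finset.sum_le_sum fun i _ => ?_)
        rw [norm_smul, mul_comm]
    _ ≤ Real.sqrt (∑ i ∈ t, ‖u i‖ ^ 2) * Real.sqrt (∑ i ∈ t, ‖inner ℝ (b i) x‖ ^ 2) :=
        Real.sum_mul_le_sqrt_mul_sqrt _ _ _
    _ ≤ Real.sqrt (∑ i ∈ t, ‖u i‖ ^ 2) * ‖x‖ := by
        gcongr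
        exact Real.sqrt_le_iff.2 ⟨norm_nonneg _, hb.sum_inner_products_le x⟩

/-- A Hilbert–Schmidt operator is compact. -/
theorem isCompactOperator_of_sum_norm_sq_le [CompleteSpace E] [CompleteSpace F]
    (D : E →L[ℝ] F) (K : ℝ)
    (h : ∀ w : Set E, Orthonormal ℝ ((↑) : w → E) → ∀ t : Finset w, ∑ i ∈ t, ‖D i‖ ^ 2 ≤ K) :
    IsCompactOperator D := by
  classical
  obtain ⟨w, b, hb⟩ := exists_hilbertBasis ℝ E
  have hbo : Orthonormal ℝ ((↑) : w → E) := hb ▸ b.orthonormal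
  have hsum : Summable fun i : w => ‖D i‖ ^ 2 :=
    summable_of_sum_le (fun i => by positivity) (h w hbo)
  set A : Finset w → E →L[ℝ] F := fun t =>
    ∑ i ∈ t, (innerSL ℝ (i : E)).smulRight (D i) with hA
  have hAx : ∀ t x, A t x = ∑ i ∈ t, inner ℝ (i : E) x • D i := fun t x => by
    simp [hA]
  have hDx : ∀ x, HasSum (fun i : w => inner ℝ (i : E) x • D i) (D x) := fun x => by
    have := (b.hasSum_repr x).mapL D
    simpa [hb, b.repr_apply_apply] using this
  -- The finite rank truncations converge in operator norm, since the error is at most the square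
  -- root of the tail of a convergent series.
  have hbound : ∀ t, ‖A t - D‖ ≤ Real.sqrt ((∑' i : w, ‖D i‖ ^ 2) - ∑ i ∈ t, ‖D i‖ ^ 2) := by
    intro t
    refine ContinuousLinearMap.opNorm_le_bound _ (Real.sqrt_nonneg _) fun x => ?_
    have hlim : Filter.Tendsto (fun t' : Finset w => ‖A t x - A t' x‖) Filter.atTop
        (nhds ‖(A t - D) x‖) := by
      have h1 : Filter.Tendsto (fun t' => A t' x) Filter.atTop (nhds (D x)) := by
        simp_rw [hAx]; exact hDx x
      exact (tendsto_const_nhds.sub h1).norm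
    refine le_of_tendsto hlim ?_
    filter_upwards [Filter.eventually_ge_atTop t] with t' ht'
    have hdiff : A t' x - A t x = ∑ i ∈ t' \ t, inner ℝ (i : E) x • D i := by
      rw [hAx, hAx, ← Finset.sum_sdiff ht']; abel
    rw [norm_sub_rev, hdiff]
    refine (norm_sum_smul_le hbo _ x _).trans ?_
    gcongr
    have h2 := hsum.sum_le_tsum t' fun i _ => by positivity
    rw [← Finset.sum_sdiff ht'] at h2
    linarith
  have htend : Filter.Tendsto A Filter.atTop (nhds D) := by
    rw [tendsto_iff_norm_sub_tendsto_zero]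
    refine squeeze_zero (fun _ => norm_nonneg _) hbound ?_
    have h1 : Filter.Tendsto (fun t : Finset w => ∑ i ∈ t, ‖D i‖ ^ 2) Filter.atTop
        (nhds (∑' i : w, ‖D i‖ ^ 2)) := hsum.hasSum
    have h2 := (Real.continuous_sqrt.tendsto _).comp
      ((tendsto_const_nhds (x := ∑' i : w, ‖D i‖ ^ 2)).sub h1)
    simpa [Function.comp_def] using h2
  refine isCompactOperator_of_tendsto htend (Filter.Eventually.of_forall fun t => ?_)
  have : A t ∈ compactOperator (RingHom.id ℝ) E F := by
    refine Submodule.sum_mem _ fun i _ => ?_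
    have h1 : IsCompactOperator (innerSL ℝ (i : E)) :=
      isCompactOperator_of_locallyCompactSpace_dom _
    exact h1.clm_comp ((ContinuousLinearMap.id ℝ ℝ).smulRight (D i))
  exact this

open ContinuousLinearMap in
/-- If a family of eigenvectors of `D D†` exhausts the nonzero eigenvalues and `D` is compact, then
`D` vanishes on the orthogonal complement of the vectors `D† (μ i)`. -/
theorem apply_eq_zero_of_forall_inner_adjoint_eq_zero [CompleteSpace E] [CompleteSpace F]
    (D : F →L[ℝ] E) (hD : IsCompactOperator D)
    {ι : Type*} (μ : ι → E) (c : ι → ℝ) (hμ : ∀ i, D (adjoint D (μ i)) = c i • μ i)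
    (hex : ∀ (a : ℝ) (f : E), a ≠ 0 → D (adjoint D f) = a • f → (∀ i, inner ℝ (μ i) f = 0) → f = 0)
    (g : F) (hg : ∀ i, inner ℝ (adjoint D (μ i)) g = 0) : D g = 0 := by
  set T : E →L[ℝ] E := D ∘L adjoint D with hT
  set N : Submodule ℝ E := (Submodule.span ℝ (Set.range μ))ᗮ with hN
  have hmem : ∀ f, f ∈ N ↔ ∀ i, inner ℝ (μ i) f = 0 := fun f => by
    rw [hN, Submodule.mem_orthogonal]
    constructor
    · exact fun h i => h _ (Submodule.subset_span ⟨i, rfl⟩)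
    · intro h u hu
      induction hu using Submodule.span_induction with
      | mem x hx => obtain ⟨i, rfl⟩ := hx; exact h i
      | zero => simp
      | add x y _ _ hx hy => rw [inner_add_left, hx, hy, add_zero]
      | smul a x _ hx => rw [inner_smul_left, hx, mul_zero]
  have hTs : ∀ f f', inner ℝ (T f) f' = inner ℝ f (T f') := fun f f' => by
    change inner ℝ (D (adjoint D f)) f' = inner ℝ f (D (adjoint D f'))
    rw [← adjoint_inner_right, ← adjoint_inner_left D]
  have hinv : ∀ f ∈ N, T f ∈ N := fun f hf => by
    rw [hmem] at hf ⊢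
    intro i
    rw [← hTs]
    have : T (μ i) = c i • μ i := hμ i
    rw [this, inner_smul_left, hf i, mul_zero]
  have hTc : IsCompactOperator T := hD.comp_clm (adjoint D)
  have hTsym : T.IsSymmetric := hTs
  set S : N →L[ℝ] N := T.restrict hinv with hS
  have hSc : IsCompactOperator S := hTc.restrict' hinv
  have hSsym : S.IsSymmetric := hTsym.restrict_invariant hinv
  -- The restriction of `D D†` to the complement of the `μ i` is compact and self-adjoint without
  -- nonzero eigenvalues, hence zero.
  have hS0 : S = 0 := by
    refine (eq_zero_of_forall_hasEigenvalue_eq_zero hSc hSsym).1 fun a ha => ?_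
    by_contra ha0
    obtain ⟨f, hf⟩ := ha.exists_hasEigenvector
    have h1 : T (f : E) = a • (f : E) := congrArg Subtype.val hf.apply_eq_smul
    exact hf.2 (Subtype.ext (hex a f ha0 h1 ((hmem _).1 f.2)))
  -- So `D D† (D g) = 0`; pairing with `D g` gives `D† D g = 0`, and pairing that with `g` gives `D
  -- g = 0`.
  have hDg : D g ∈ N := (hmem _).2 fun i => by rw [← adjoint_inner_left]; exact hg i
  have h1 : T (D g) = 0 := by
    have h0 : S ⟨D g, hDg⟩ = 0 := by rw [hS0]; rfl
    exact congrArg Subtype.val h0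
  have h2 : adjoint D (D g) = 0 := by
    have : inner ℝ (adjoint D (D g)) (adjoint D (D g)) = 0 := by
      rw [adjoint_inner_left]
      change inner ℝ (D g) (T (D g)) = 0
      rw [h1, inner_zero_right]
    exact inner_self_eq_zero.1 this
  have : inner ℝ (D g) (D g) = 0 := by
    rw [← adjoint_inner_left, h2, inner_zero_left]
  exact inner_self_eq_zero.1 this

end HilbertSchmidt

/-! ### Ky Fan's principle and the Gram matrix -/

section KyFan

/-- Bathtub principle: termwise `a t ≤ τ t + (a - τ) 1_J`. The mass condition carries the factor
`τ`, so it is void for `τ = 0`, when `J` may be too small. -/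
lemma hasSum_mul_le_sum {ι : Type*} {a t : ι → ℝ} {J : Finset ι} {τ T S : ℝ}
    (haJ : ∀ i ∈ J, τ ≤ a i) (haJ' : ∀ i ∉ J, a i ≤ τ) (ht0 : ∀ i, 0 ≤ t i) (ht1 : ∀ i, t i ≤ 1)
    (hT : HasSum t T) (hTJ : T * τ ≤ J.card * τ) (hS : HasSum (fun i => a i * t i) S) :
    S ≤ ∑ i ∈ J, a i := by
  classical
  have h1 : HasSum (fun i => if i ∈ J then a i - τ else 0) (∑ i ∈ J, (a i - τ)) := by
    have := hasSum_sum_of_ne_finset_zero (L := .unconditional ι) (s := J)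
      (f := fun i => if i ∈ J then a i - τ else 0)
      fun i hi => by simp [hi]
    convert this using 1
    exact Finset.sum_congr rfl fun i hi => by simp [hi]
  have h2 : HasSum (fun i => t i * τ + if i ∈ J then a i - τ else 0)
      (T * τ + ∑ i ∈ J, (a i - τ)) := (hT.mul_right τ).add h1
  have hle : ∀ i, a i * t i ≤ t i * τ + if i ∈ J then a i - τ else 0 := fun i => by
    split_ifs with hi
    · nlinarith [haJ i hi, ht0 i, ht1 i]
    · nlinarith [haJ' i hi, ht0 i, ht1 i]
  have h3 := hasSum_le hle hS h2
  rw [Finset.sum_sub_distrib, Finset.sum_const, nsmul_eq_mul] at h3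
  linarith

variable {H : Type*} [NormedAddCommGroup H] [InnerProductSpace ℝ H]

/-- The feature space combination `∑ⱼ v[j] Cⱼ`. -/
def combine {m : ℕ} (C : Fin m → H) (v : EuclideanSpace ℝ (Fin m)) : H := ∑ j, v j • C j

variable {m : ℕ} {C : Fin m → H} {lam : Fin m → ℝ} {v : Fin m → EuclideanSpace ℝ (Fin m)}

/-- The inner product of two combinations is the bilinear form of the Gram matrix, which its
eigenvectors diagonalize. -/
lemma inner_combine_combine
    (hv : IsEigendecomposition (Matrix.of fun i j => inner ℝ (C i) (C j)) lam v) (k l : Fin m) :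
    inner ℝ (combine C (v k)) (combine C (v l)) = if k = l then lam l else 0 := by
  have h1 : inner ℝ (combine C (v k)) (combine C (v l)) = lam l * inner ℝ (v k) (v l) := by
    have he := hv.eigen l
    simp only [combine, sum_inner, inner_sum, inner_smul_left, inner_smul_right]
    simp only [Finset.mul_sum]
    rw [Finset.sum_comm]
    simp only [RCLike.conj_to_real, PiLp.inner_apply, RCLike.inner_apply, Finset.mul_sum]
    refine Finset.sum_congr rfl fun i _ => ?_
    have hi := congrFun he i
    simp only [Matrix.mulVec, dotProduct, Matrix.of_apply, Pi.smul_apply, smul_eq_mul] at hi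
    calc _ = v k i * ∑ j, inner ℝ (C i) (C j) * v l j := by
          rw [Finset.mul_sum]; exact Finset.sum_congr rfl fun j _ => by ring
      _ = _ := by rw [hi]; ring
  rw [h1, orthonormal_iff_ite.1 hv.orthonormal k l]
  split_ifs <;> simp

lemma norm_sq_combine
    (hv : IsEigendecomposition (Matrix.of fun i j => inner ℝ (C i) (C j)) lam v) (k : Fin m) :
    ‖combine C (v k)‖ ^ 2 = lam k := by
  rw [← real_inner_self_eq_norm_sq, inner_combine_combine hv, if_pos rfl]

lemma eigenvalue_nonneg
    (hv : IsEigendecomposition (Matrix.of fun i j => inner ℝ (C i) (C j)) lam v) (k : Fin m) :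
    0 ≤ lam k := norm_sq_combine hv k ▸ sq_nonneg _

/-- Parseval in `ℝᵐ` for the vector `(⟨Cⱼ, q⟩)ⱼ`, as `m` orthonormal vectors form a basis. -/
lemma sum_inner_sq_eq_sum_inner_combine_sq {v : Fin m → EuclideanSpace ℝ (Fin m)}
    (hv : Orthonormal ℝ v) (q : H) :
    ∑ j, inner ℝ (C j) q ^ 2 = ∑ k, inner ℝ (combine C (v k)) q ^ 2 := by
  have hb : ∃ b : OrthonormalBasis (Fin m) ℝ (EuclideanSpace ℝ (Fin m)), ⇑b = v := by
    have hsp := hv.linearIndependent.span_eq_top_of_card_eq_finrank' (by simp)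
    exact ⟨OrthonormalBasis.mk hv hsp.ge, OrthonormalBasis.coe_mk _ _⟩
  obtain ⟨b, rfl⟩ := hb
  set y : EuclideanSpace ℝ (Fin m) := WithLp.toLp 2 fun j => inner ℝ (C j) q with hy
  have h1 := b.sum_sq_norm_inner_right y
  rw [EuclideanSpace.norm_sq_eq] at h1
  have h2 : ∀ k, inner ℝ (b k) y = inner ℝ (combine C (b k)) q := fun k => by
    simp only [combine, sum_inner, inner_smul_left, PiLp.inner_apply, hy]
    exact Finset.sum_congr rfl fun j _ => by simp [mul_comm]
  simp only [h2, Real.norm_eq_abs, sq_abs] at h1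
  exact h1.symm

/-- The normalized empirical eigenvector in feature space. -/
def empiricalEigenvector (C : Fin m → H) (lam : Fin m → ℝ)
    (v : Fin m → EuclideanSpace ℝ (Fin m)) (k : Fin m) : H :=
  (1 / Real.sqrt (lam k)) • combine C (v k)

lemma orthonormal_empiricalEigenvector
    (hv : IsEigendecomposition (Matrix.of fun i j => inner ℝ (C i) (C j)) lam v) {κ : Type*}
    {e : κ → Fin m} (he : Function.Injective e) (hpos : ∀ i, 0 < lam (e i)) :
    Orthonormal ℝ fun i => empiricalEigenvector C lam v (e i) := by
  classical
  rw [orthonormal_iff_ite]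
  intro i j
  simp only [empiricalEigenvector, inner_smul_left, inner_smul_right, inner_combine_combine hv,
    he.eq_iff]
  split_ifs with h
  · subst h
    have := Real.mul_self_sqrt (hpos i).le
    have h0 : Real.sqrt (lam (e i)) ≠ 0 := (Real.sqrt_pos.2 (hpos i)).ne'
    simp only [RCLike.conj_to_real]
    field_simp
    rw [sq, this]
  · simp

/-- No positivity is needed: where the eigenvalue is zero the combination itself is zero. -/
lemma inner_combine_sq_eq
    (hv : IsEigendecomposition (Matrix.of fun i j => inner ℝ (C i) (C j)) lam v) (k : Fin m)
    (q : H) :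
    inner ℝ (combine C (v k)) q ^ 2 = lam k * inner ℝ (empiricalEigenvector C lam v k) q ^ 2 := by
  rw [empiricalEigenvector, inner_smul_left, RCLike.conj_to_real]
  rcases (eigenvalue_nonneg hv k).eq_or_lt with h | h
  · have : combine C (v k) = 0 := by
      have := norm_sq_combine hv k
      rw [← h] at this
      simpa using this
    rw [this, ← h]; simp
  · rw [mul_pow, div_pow, Real.sq_sqrt h.le]
    field_simp

lemma sum_inner_sq_empiricalEigenvector
    (hv : IsEigendecomposition (Matrix.of fun i j => inner ℝ (C i) (C j)) lam v)
    {i : Fin m} (hi : 0 < lam i) :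
    ∑ j, inner ℝ (C j) (empiricalEigenvector C lam v i) ^ 2 = lam i := by
  rw [sum_inner_sq_eq_sum_inner_combine_sq hv.orthonormal]
  have : ∀ k, inner ℝ (combine C (v k)) (empiricalEigenvector C lam v i) ^ 2 =
      if k = i then lam i else 0 := fun k => by
    rw [empiricalEigenvector, inner_smul_right, inner_combine_combine hv]
    split_ifs
    · rw [mul_pow, div_pow, Real.sq_sqrt hi.le]; field_simp
    · simp
  simp [this]

/-- The top empirical eigenvectors maximize the captured empirical energy. -/
theorem sum_sum_inner_sq_le_sum_eigenvalues
    (hv : IsEigendecomposition (Matrix.of fun i j => inner ℝ (C i) (C j)) lam v)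
    {d : ℕ} (hdm : d ≤ m) {κ : Type*} [Fintype κ] (hκ : Fintype.card κ ≤ d) {q : κ → H}
    (hq : Orthonormal ℝ q) :
    ∑ i, ∑ j, inner ℝ (C j) (q i) ^ 2 ≤ ∑ i : Fin d, lam (Fin.castLE hdm i) := by
  classical
  -- The weight of the family `q` on the `k`-th empirical eigenvector. Bessel for `q` bounds each
  -- weight by one, and Bessel for the empirical eigenvectors bounds the total by `d`.
  set t : Fin m → ℝ := fun k =>
    if lam k = 0 then 0 else ∑ i, inner ℝ (empiricalEigenvector C lam v k) (q i) ^ 2 with ht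
  set J : Finset (Fin m) := Finset.univ.map (Fin.castLEEmb hdm) with hJ
  have hJmem : ∀ i, i ∈ J ↔ (i : ℕ) < d := fun i => by
    simp only [hJ, Finset.mem_map, Finset.mem_univ, true_and]
    constructor
    · rintro ⟨a, rfl⟩; exact a.2
    · exact fun h => ⟨⟨i, h⟩, Fin.ext rfl⟩
  have hpn : ∀ k, lam k ≠ 0 → ‖empiricalEigenvector C lam v k‖ = 1 := fun k hk =>
    (orthonormal_empiricalEigenvector hv (κ := Unit) (e := fun _ => k)
      (Function.injective_of_subsingleton _)
      fun _ => lt_of_le_of_ne (eigenvalue_nonneg hv k) (Ne.symm hk)).1 ()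
  have ht0 : ∀ k, 0 ≤ t k := fun k => by
    simp only [ht]; split_ifs
    · exact le_rfl
    · exact Finset.sum_nonneg fun i _ => sq_nonneg _
  have ht1 : ∀ k, t k ≤ 1 := fun k => by
    simp only [ht]; split_ifs with hk
    · exact zero_le_one
    · have := hq.sum_inner_products_le (x := empiricalEigenvector C lam v k) (s := Finset.univ)
      rw [hpn k hk] at this
      simpa [real_inner_comm] using this
  have hsum : ∑ k, t k ≤ d := by
    have h1 : ∑ k, t k = ∑ k : {k // lam k ≠ 0}, ∑ i,
        inner ℝ (empiricalEigenvector C lam v k) (q i) ^ 2 := by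
      rw [← Finset.sum_subtype (Finset.univ.filter fun k => lam k ≠ 0) (by simp)
        (fun k => ∑ i, inner ℝ (empiricalEigenvector C lam v k) (q i) ^ 2), Finset.sum_filter]
      refine Finset.sum_congr rfl fun k _ => ?_
      simp only [ht, ne_eq, ite_not]
    rw [h1, Finset.sum_comm]
    have ho := orthonormal_empiricalEigenvector hv (κ := {k // lam k ≠ 0}) (e := fun k => k)
      Subtype.val_injective fun k => lt_of_le_of_ne (eigenvalue_nonneg hv k) (Ne.symm k.2)
    calc _ ≤ ∑ _i : κ, (1 : ℝ) := by
          refine Finset.sum_le_sum fun i _ => ?_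
          have := ho.sum_inner_products_le (x := q i) (s := Finset.univ)
          rw [hq.1 i] at this
          simpa using this
      _ = Fintype.card κ := by simp
      _ ≤ d := by exact_mod_cast hκ
  have hS : ∑ i, ∑ j, inner ℝ (C j) (q i) ^ 2 = ∑ k, lam k * t k := by
    simp_rw [sum_inner_sq_eq_sum_inner_combine_sq (C := C) hv.orthonormal]
    rw [Finset.sum_comm]
    refine Finset.sum_congr rfl fun k _ => ?_
    simp_rw [inner_combine_sq_eq hv, ← Finset.mul_sum]
    by_cases hk : lam k = 0 <;> simp [ht, hk]
  have hmain : ∀ τ : ℝ, 0 ≤ τ → (∀ i ∈ J, τ ≤ lam i) → (∀ i ∉ J, lam i ≤ τ) →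
      ∑ k, lam k * t k ≤ ∑ i ∈ J, lam i := fun τ hτ h1 h2 =>
    hasSum_mul_le_sum h1 h2 ht0 ht1 (hasSum_fintype t)
      (by gcongr; simpa [hJ] using hsum) (hasSum_fintype _)
  have hfin : ∑ i ∈ J, lam i = ∑ i : Fin d, lam (Fin.castLE hdm i) := by
    simp [hJ]
  rw [hS, ← hfin]
  -- The threshold is the first eigenvalue left out, or zero if none is left out.
  rcases hdm.eq_or_lt with h | h
  · refine hmain 0 le_rfl (fun i _ => eigenvalue_nonneg hv i) fun i hi => ?_
    exact absurd ((hJmem i).2 (h ▸ i.2)) hi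
  · refine hmain (lam ⟨d, h⟩) (eigenvalue_nonneg hv _) (fun i hi => ?_) fun i hi => ?_
    · exact hv.antitone (Fin.le_def.2 ((hJmem i).1 hi).le)
    · exact hv.antitone (Fin.le_def.2 (not_lt.1 fun hlt => hi ((hJmem i).2 hlt)))

end KyFan

/-! ### From small energy on the complement to small distance -/

section Geometry

variable {H E : Type*} [NormedAddCommGroup H] [InnerProductSpace ℝ H]
  [NormedAddCommGroup E] [InnerProductSpace ℝ E]

/-- If `F` is small on the orthogonal complement of a subspace, then a vector on which `F` is large
is close to the subspace. -/
theorem norm_sq_orthogonal_part_le (F : H →ₗ[ℝ] E) {σ τ θ : ℝ} {g g₁ g₂ : H} (hg : g = g₁ + g₂)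
    (h12 : inner ℝ g₁ g₂ = 0) (hσ : 0 ≤ σ) (hF₁ : ‖F g₁‖ ≤ σ * ‖g₁‖)
    (hτ : 0 ≤ τ) (hF₂ : ‖F g₂‖ ^ 2 ≤ τ * ‖g₂‖ ^ 2) (hθ : θ * ‖g‖ ^ 2 ≤ ‖F g‖ ^ 2) :
    (σ ^ 2 - τ) * ‖g₂‖ ^ 2 ≤ (σ ^ 2 - θ + σ * Real.sqrt τ) * ‖g‖ ^ 2 := by
  have hpy : ‖g‖ ^ 2 = ‖g₁‖ ^ 2 + ‖g₂‖ ^ 2 := by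
    rw [hg, norm_add_sq_real, h12]; ring
  have hF₂' : ‖F g₂‖ ≤ Real.sqrt τ * ‖g₂‖ := by
    refine le_of_sq_le_sq ?_ (by positivity)
    rw [mul_pow, Real.sq_sqrt hτ]; exact hF₂
  have hFg : ‖F g‖ ≤ σ * ‖g₁‖ + Real.sqrt τ * ‖g₂‖ := by
    rw [hg, map_add]; exact (norm_add_le _ _).trans (add_le_add hF₁ hF₂')
  have hFg2 : ‖F g‖ ^ 2 ≤ (σ * ‖g₁‖ + Real.sqrt τ * ‖g₂‖) ^ 2 := by gcongr
  have hs : Real.sqrt τ ^ 2 = τ := Real.sq_sqrt hτ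
  -- `F g₁` and `F g₂` need not be orthogonal; their cross term is the source of the summand `σ √τ`.
  have hcross : 2 * (‖g₁‖ * ‖g₂‖) ≤ ‖g‖ ^ 2 := by
    rw [hpy]; nlinarith [sq_nonneg (‖g₁‖ - ‖g₂‖)]
  have hcross' := mul_le_mul_of_nonneg_left hcross (mul_nonneg hσ (Real.sqrt_nonneg τ))
  have hexp : (σ * ‖g₁‖ + Real.sqrt τ * ‖g₂‖) ^ 2 =
      σ ^ 2 * ‖g₁‖ ^ 2 + σ * Real.sqrt τ * (2 * (‖g₁‖ * ‖g₂‖)) + τ * ‖g₂‖ ^ 2 := by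
    linear_combination ‖g₂‖ ^ 2 * hs
  rw [hexp] at hFg2
  have : ‖g₁‖ ^ 2 = ‖g‖ ^ 2 - ‖g₂‖ ^ 2 := by linarith
  rw [this] at hFg2
  linarith

end Geometry

/-! ### Orthonormal series and `ℓ²` -/

section OrthonormalSeries

variable {E ι : Type*} [NormedAddCommGroup E] [InnerProductSpace ℝ E] {b : ι → E}

lemma summable_smul_of_orthonormal [CompleteSpace E] (hb : Orthonormal ℝ b) {a : ι → ℝ}
    (ha : Summable fun i => a i ^ 2) : Summable fun i => a i • b i := by
  have := (hb.orthogonalFamily.summable_iff_norm_sq_summable a).2 (by simpa using ha)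
  simpa using this

lemma inner_eq_of_hasSum_smul (hb : Orthonormal ℝ b) {a : ι → ℝ} {f : E}
    (hf : HasSum (fun i => a i • b i) f) (j : ι) : inner ℝ (b j) f = a j := by
  classical
  have h := hf.mapL (innerSL ℝ (b j))
  simp only [innerSL_apply_apply, inner_smul_right, orthonormal_iff_ite.1 hb] at h
  have h2 := hasSum_ite_eq (L := .unconditional ι) j (a j)
  refine h.unique ?_
  refine h2.congr_fun fun i => ?_
  by_cases hij : j = i
  · subst hij; simp
  · simp [hij, Ne.symm hij]

lemma hasSum_sq_of_hasSum_smul (hb : Orthonormal ℝ b) {a : ι → ℝ} {f : E}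
    (hf : HasSum (fun i => a i • b i) f) : HasSum (fun i => a i ^ 2) (‖f‖ ^ 2) := by
  have h := hf.mapL (innerSL ℝ f)
  simp only [innerSL_apply_apply, inner_smul_right, real_inner_self_eq_norm_sq] at h
  refine h.congr_fun fun i => ?_
  rw [real_inner_comm, inner_eq_of_hasSum_smul hb hf, sq]

/-- The isometric embedding of `ℓ²` defined by an orthonormal family. -/
def orthonormalEmbedding [CompleteSpace E] (hb : Orthonormal ℝ b) :
    lp (fun _ : ι => ℝ) 2 →ₗᵢ[ℝ] E := hb.orthogonalFamily.linearIsometry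

lemma hasSum_orthonormalEmbedding [CompleteSpace E] (hb : Orthonormal ℝ b)
    (p : lp (fun _ : ι => ℝ) 2) :
    HasSum (fun i => p i • b i) (orthonormalEmbedding hb p) := by
  have := hb.orthogonalFamily.hasSum_linearIsometry p
  simpa [orthonormalEmbedding] using this

lemma lp_summable_sq (p : lp (fun _ : ι => ℝ) 2) : Summable fun i => p i ^ 2 := by
  have := (lp.memℓp p).summable (by norm_num)
  simpa using this

lemma lp_hasSum_inner (p q : lp (fun _ : ι => ℝ) 2) :
    HasSum (fun i => p i * q i) (inner ℝ p q) := by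
  have := lp.hasSum_inner (𝕜 := ℝ) p q
  simpa [mul_comm] using this

lemma lp_hasSum_sq (p : lp (fun _ : ι => ℝ) 2) : HasSum (fun i => p i ^ 2) (‖p‖ ^ 2) := by
  have := lp_hasSum_inner p p
  simpa [real_inner_self_eq_norm_sq, sq] using this

lemma memℓp_two_of_summable {u : ι → ℝ} (hu : Summable fun i => u i ^ 2) : Memℓp u 2 :=
  (memℓp_gen_iff (by norm_num)).2 (by simpa using hu)

/-- A pointwise limit of the truncations to finitely many coordinates. -/
lemma stronglyMeasurable_lp {X : Type*} [MeasurableSpace X] [Countable ι]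
    {C : X → lp (fun _ : ι => ℝ) 2} (hC : ∀ i, Measurable fun x => C x i) :
    StronglyMeasurable C := by
  classical
  refine stronglyMeasurable_of_tendsto (u := Filter.atTop)
    (f := fun (t : Finset ι) x => ∑ i ∈ t, lp.single 2 i (C x i)) (fun t => ?_) ?_
  · refine Finset.stronglyMeasurable_fun_sum _ fun i _ => ?_
    have : ∀ x, lp.single (E := fun _ : ι => ℝ) 2 i (C x i) =
        C x i • lp.single (E := fun _ : ι => ℝ) 2 i (1 : ℝ) := fun x => by
      rw [← lp.single_smul, smul_eq_mul, mul_one]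
    simp_rw [this]
    exact (hC i).stronglyMeasurable.smul_const _
  · rw [tendsto_pi_nhds]
    exact fun x => lp.hasSum_single (by norm_num) (C x)

end OrthonormalSeries

/-! ### The operator of a bounded feature map -/

section FeatureOperator

variable {X : Type*} [MeasurableSpace X] {G : Type*} [NormedAddCommGroup G]
  [InnerProductSpace ℝ G] {φ : X → G} {K : ℝ}

lemma memLp_inner_feature (ν : Measure X) [IsProbabilityMeasure ν]
    (hm : ∀ g, StronglyMeasurable fun x => inner ℝ (φ x) g) (hK : ∀ x, ‖φ x‖ ≤ K) (g : G) :
    MemLp (fun x => inner ℝ (φ x) g) 2 ν :=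
  MemLp.of_bound (hm g).aestronglyMeasurable (K * ‖g‖) (Filter.Eventually.of_forall fun x =>
    (norm_inner_le_norm _ _).trans (by gcongr; exact hK x))

/-- The operator `g ↦ ⟨φ(·), g⟩` from a feature space to `L²`. -/
def featureOp (ν : Measure X) [IsProbabilityMeasure ν]
    (hm : ∀ g, StronglyMeasurable fun x => inner ℝ (φ x) g) (hK : ∀ x, ‖φ x‖ ≤ K) :
    G →L[ℝ] Lp ℝ 2 ν :=
  LinearMap.mkContinuous
    { toFun := fun g => (memLp_inner_feature ν hm hK g).toLp _
      map_add' := fun g g' => by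
        rw [← MemLp.toLp_add]
        exact MemLp.toLp_congr _ _ (Filter.Eventually.of_forall fun x => inner_add_right _ _ _)
      map_smul' := fun c g => by
        rw [RingHom.id_apply, ← MemLp.toLp_const_smul]
        exact MemLp.toLp_congr _ _ (Filter.Eventually.of_forall fun x => inner_smul_right _ _ _) }
    K fun g => by
      have hK0 : 0 ≤ K :=
        (norm_nonneg _).trans (hK (nonempty_of_isProbabilityMeasure ν).some)
      have h := Lp.norm_le_of_ae_bound (μ := ν) (p := 2)
        (f := (memLp_inner_feature ν hm hK g).toLp _) (C := K * ‖g‖) (by positivity) (by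
          filter_upwards [(memLp_inner_feature ν hm hK g).coeFn_toLp] with x hx
          rw [hx]
          exact (norm_inner_le_norm _ _).trans (by gcongr; exact hK x))
      simpa [measureUnivNNReal] using h

variable (ν : Measure X) [IsProbabilityMeasure ν]
  (hm : ∀ g, StronglyMeasurable fun x => inner ℝ (φ x) g) (hK : ∀ x, ‖φ x‖ ≤ K)

lemma featureOp_ae (g : G) : featureOp ν hm hK g =ᵐ[ν] fun x => inner ℝ (φ x) g :=
  (memLp_inner_feature ν hm hK g).coeFn_toLp

lemma inner_featureOp (f : Lp ℝ 2 ν) (g : G) :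
    inner ℝ f (featureOp ν hm hK g) = ∫ x, f x * inner ℝ (φ x) g ∂ν := by
  rw [L2.inner_def]
  refine integral_congr_ae ?_
  filter_upwards [featureOp_ae ν hm hK g] with x hx
  simp [hx, mul_comm]

lemma norm_sq_featureOp (g : G) :
    ‖featureOp ν hm hK g‖ ^ 2 = ∫ x, inner ℝ (φ x) g ^ 2 ∂ν := by
  rw [← real_inner_self_eq_norm_sq, inner_featureOp]
  refine integral_congr_ae ?_
  filter_upwards [featureOp_ae ν hm hK g] with x hx
  simp [hx, sq]

lemma integrable_inner_sq (ν : Measure X) [IsProbabilityMeasure ν]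
    (hm : ∀ g, StronglyMeasurable fun x => inner ℝ (φ x) g) (hK : ∀ x, ‖φ x‖ ≤ K) (g : G) :
    Integrable (fun x => inner ℝ (φ x) g ^ 2) ν :=
  (memLp_inner_feature ν hm hK g).integrable_sq

/-- Hilbert–Schmidt: Bessel gives `∑ ⟨φ x, eᵢ⟩² ≤ K²` at each `x`, and this is integrated. -/
theorem isCompactOperator_featureOp [CompleteSpace G] : IsCompactOperator (featureOp ν hm hK) := by
  refine isCompactOperator_of_sum_norm_sq_le _ (K ^ 2) fun w hw t => ?_
  simp_rw [norm_sq_featureOp]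
  rw [← integral_finsetSum _ fun i _ => integrable_inner_sq ν hm hK _]
  calc _ ≤ ∫ _x, K ^ 2 ∂ν := by
        refine integral_mono (integrable_finsetSum _ fun i _ => integrable_inner_sq ν hm hK _)
          (integrable_const _) fun x => ?_
        have h1 := hw.sum_inner_products_le (φ x) (s := t)
        have h2 := hK x
        have h3 : ‖φ x‖ ^ 2 ≤ K ^ 2 := by gcongr
        refine le_trans (le_of_eq ?_) (h1.trans h3)
        refine Finset.sum_congr rfl fun i _ => ?_
        rw [real_inner_comm, Real.norm_eq_abs, sq_abs]
    _ = K ^ 2 := by simp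

end FeatureOperator

/-! ### Features as sections of a square integrable function on the product -/

section ProductSpace

variable {X A : Type*} [MeasurableSpace X] [MeasurableSpace A]

/-- π-λ argument: rectangles form a π-system generating the product σ-algebra. -/
lemma ae_eq_zero_of_forall_setIntegral_prod {ρ : Measure (X × A)} {z : X × A → ℝ}
    (hz : Integrable z ρ)
    (h : ∀ S T, MeasurableSet S → MeasurableSet T → ∫ p in S ×ˢ T, z p ∂ρ = 0) : z =ᵐ[ρ] 0 := by
  suffices h' : ∀ U, MeasurableSet U → ∫ p in U, z p ∂ρ = 0 from
    hz.ae_eq_zero_of_forall_setIntegral_eq_zero fun U hU _ => h' U hU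
  intro U hU
  induction U, hU using MeasurableSpace.induction_on_inter generateFrom_prod.symm
    isPiSystem_prod with
  | empty => simp
  | basic U hU =>
    obtain ⟨S, hS, T, hT, rfl⟩ := hU
    exact h S T hS hT
  | compl U hU ih =>
    have h1 := integral_add_compl hU hz
    have h2 := h Set.univ Set.univ .univ .univ
    rw [Set.univ_prod_univ, setIntegral_univ] at h2
    linarith
  | iUnion U hd hU ih =>
    rw [integral_iUnion hU hd hz.integrableOn]
    simp [ih]

variable {ν : Measure X} {π : Measure A} [IsProbabilityMeasure ν] [IsProbabilityMeasure π]

lemma memLp_mul_prod (f : Lp ℝ 2 ν) (g : Lp ℝ 2 π) :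
    MemLp (fun z : X × A => f z.1 * g z.2) 2 (ν.prod π) := by
  have hm : AEStronglyMeasurable (fun z : X × A => f z.1 * g z.2) (ν.prod π) :=
    (((Lp.stronglyMeasurable f).comp_measurable measurable_fst).mul
      ((Lp.stronglyMeasurable g).comp_measurable measurable_snd)).aestronglyMeasurable
  rw [memLp_two_iff_integrable_sq hm]
  simp_rw [mul_pow]
  exact (Lp.memLp f).integrable_sq.mul_prod (Lp.memLp g).integrable_sq

/-- The tensor product `f ⊗ g` of square integrable functions. -/
def prodTensor (f : Lp ℝ 2 ν) (g : Lp ℝ 2 π) : Lp ℝ 2 (ν.prod π) := (memLp_mul_prod f g).toLp _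

lemma inner_prodTensor_left (f : Lp ℝ 2 ν) (g : Lp ℝ 2 π) (R : Lp ℝ 2 (ν.prod π)) :
    inner ℝ (prodTensor f g) R = ∫ z, f z.1 * g z.2 * R z ∂(ν.prod π) := by
  rw [L2.inner_def]
  refine integral_congr_ae ?_
  filter_upwards [(memLp_mul_prod f g).coeFn_toLp] with z hz
  rw [prodTensor, hz]
  simp [mul_comm]

lemma inner_prodTensor (f f' : Lp ℝ 2 ν) (g g' : Lp ℝ 2 π) :
    inner ℝ (prodTensor f g) (prodTensor f' g') = inner ℝ f f' * inner ℝ g g' := by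
  rw [inner_prodTensor_left, L2.inner_def, L2.inner_def, ← integral_prod_mul]
  refine integral_congr_ae ?_
  filter_upwards [(memLp_mul_prod f' g').coeFn_toLp] with z hz
  rw [prodTensor, hz]
  simp only [RCLike.inner_apply, RCLike.conj_to_real]
  ring

lemma orthonormal_prodTensor {ι : Type*} {μ : ι → Lp ℝ 2 ν} {e : ι → Lp ℝ 2 π}
    (hμ : Orthonormal ℝ μ) (he : Orthonormal ℝ e) :
    Orthonormal ℝ fun i => prodTensor (μ i) (e i) := by
  classical
  rw [orthonormal_iff_ite] at hμ he ⊢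
  intro i j
  rw [inner_prodTensor, hμ, he]
  split_ifs <;> simp

lemma eq_zero_of_forall_inner_prodTensor {R : Lp ℝ 2 (ν.prod π)}
    (h : ∀ f g, inner ℝ (prodTensor f g) R = 0) : R = 0 := by
  have hR : Integrable R (ν.prod π) := (Lp.memLp R).integrable (by norm_num)
  refine Lp.eq_zero_iff_ae_eq_zero.2 (ae_eq_zero_of_forall_setIntegral_prod hR fun S T hS hT => ?_)
  have h1 := h (indicatorConstLp 2 hS (measure_ne_top _ _) (1 : ℝ))
    (indicatorConstLp 2 hT (measure_ne_top _ _) (1 : ℝ))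
  rw [inner_prodTensor_left] at h1
  rw [← h1, ← integral_indicator (hS.prod hT)]
  refine integral_congr_ae ?_
  have hS' := Measure.quasiMeasurePreserving_fst (μ := ν) (ν := π) |>.ae
    (indicatorConstLp_coeFn (p := 2) (hs := hS) (hμs := measure_ne_top ν S) (c := (1 : ℝ)))
  have hT' := Measure.quasiMeasurePreserving_snd (μ := ν) (ν := π) |>.ae
    (indicatorConstLp_coeFn (p := 2) (hs := hT) (hμs := measure_ne_top π T) (c := (1 : ℝ)))
  filter_upwards [hS', hT'] with z h2 h3
  rw [h2, h3]
  by_cases hz1 : z.1 ∈ S <;> by_cases hz2 : z.2 ∈ T <;> simp [Set.indicator, hz1, hz2]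

variable {w : X × A → ℝ} {φ : X → Lp ℝ 2 π} {K : ℝ}

/-- Separability of `L²(π)` is not assumed, so the features enter only through scalar products. -/
lemma stronglyMeasurable_inner_section (hw : Measurable w)
    (hφ : ∀ x, φ x =ᵐ[π] fun a => w (x, a)) (g : Lp ℝ 2 π) :
    StronglyMeasurable fun x => inner ℝ (φ x) g := by
  have h1 : StronglyMeasurable fun z : X × A => w z * g z.2 :=
    hw.stronglyMeasurable.mul ((Lp.stronglyMeasurable g).comp_measurable measurable_snd)
  have h2 := h1.integral_prod_right' (ν := π)
  convert h2 using 2 with x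
  rw [L2.inner_def]
  refine integral_congr_ae ?_
  filter_upwards [hφ x] with a ha
  simp [ha, mul_comm]

lemma norm_sq_section (hφ : ∀ x, φ x =ᵐ[π] fun a => w (x, a)) (x : X) :
    ‖φ x‖ ^ 2 = ∫ a, w (x, a) ^ 2 ∂π := by
  rw [← real_inner_self_eq_norm_sq, L2.inner_def]
  refine integral_congr_ae ?_
  filter_upwards [hφ x] with a ha
  simp [ha, sq]

lemma stronglyMeasurable_norm_sq_section (hw : Measurable w)
    (hφ : ∀ x, φ x =ᵐ[π] fun a => w (x, a)) : StronglyMeasurable fun x => ‖φ x‖ ^ 2 := by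
  simp_rw [norm_sq_section hφ]
  exact (hw.stronglyMeasurable.pow 2).integral_prod_right' (ν := π)

lemma integrable_norm_sq_section (hw : Measurable w) (hφ : ∀ x, φ x =ᵐ[π] fun a => w (x, a))
    (hK : ∀ x, ‖φ x‖ ≤ K) : Integrable (fun x => ‖φ x‖ ^ 2) ν := by
  refine Integrable.of_bound (stronglyMeasurable_norm_sq_section hw hφ).aestronglyMeasurable (K ^ 2)
    (Filter.Eventually.of_forall fun x => ?_)
  rw [Real.norm_eq_abs, abs_of_nonneg (by positivity)]
  have := hK x
  gcongr

lemma memLp_of_section (hw : Measurable w) (hφ : ∀ x, φ x =ᵐ[π] fun a => w (x, a))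
    (hK : ∀ x, ‖φ x‖ ≤ K) : MemLp w 2 (ν.prod π) := by
  rw [memLp_two_iff_integrable_sq hw.aestronglyMeasurable,
    integrable_prod_iff (hw.pow_const 2).aestronglyMeasurable]
  constructor
  · refine Filter.Eventually.of_forall fun x => ?_
    exact ((memLp_congr_ae (hφ x)).1 (Lp.memLp (φ x))).integrable_sq
  · have := integrable_norm_sq_section (ν := ν) hw hφ hK
    simp_rw [norm_sq_section hφ] at this
    simpa using this

/-- Fubini: `w` is the Hilbert–Schmidt kernel of the feature operator. -/
lemma inner_prodTensor_section (hw : Measurable w) (hφ : ∀ x, φ x =ᵐ[π] fun a => w (x, a))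
    (hK : ∀ x, ‖φ x‖ ≤ K) (f : Lp ℝ 2 ν) (g : Lp ℝ 2 π) :
    inner ℝ (prodTensor f g) ((memLp_of_section hw hφ hK).toLp w) =
      inner ℝ f (featureOp ν (stronglyMeasurable_inner_section hw hφ) hK g) := by
  have hW := memLp_of_section (ν := ν) hw hφ hK
  rw [inner_prodTensor_left, inner_featureOp]
  have h1 : ∫ z, f z.1 * g z.2 * (hW.toLp w) z ∂(ν.prod π) =
      ∫ z, f z.1 * g z.2 * w z ∂(ν.prod π) := by
    refine integral_congr_ae ?_
    filter_upwards [hW.coeFn_toLp] with z hz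
    rw [hz]
  have h2 : Integrable (fun z => f z.1 * g z.2 * w z) (ν.prod π) :=
    (memLp_mul_prod f g).integrable_mul hW
  rw [h1, integral_prod _ h2]
  refine integral_congr_ae (Filter.Eventually.of_forall fun x => ?_)
  dsimp only
  simp_rw [mul_assoc]
  rw [integral_const_mul, L2.inner_def]
  congr 1
  refine integral_congr_ae ?_
  filter_upwards [hφ x] with a ha
  simp [ha]

lemma norm_sq_toLp_section (hw : Measurable w) (hφ : ∀ x, φ x =ᵐ[π] fun a => w (x, a))
    (hK : ∀ x, ‖φ x‖ ≤ K) :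
    ‖(memLp_of_section (ν := ν) hw hφ hK).toLp w‖ ^ 2 = ∫ x, ‖φ x‖ ^ 2 ∂ν := by
  have hW := memLp_of_section (ν := ν) hw hφ hK
  rw [← real_inner_self_eq_norm_sq, L2.inner_def]
  have h1 : ∫ z, inner ℝ ((hW.toLp w) z) ((hW.toLp w) z) ∂(ν.prod π) =
      ∫ z, w z ^ 2 ∂(ν.prod π) := by
    refine integral_congr_ae ?_
    filter_upwards [hW.coeFn_toLp] with z hz
    rw [hz]
    simp [sq]
  rw [h1, integral_prod _ hW.integrable_sq]
  simp_rw [norm_sq_section hφ]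

/-- If `D g = ⟨φ(·), g⟩` vanishes on the orthogonal complement of an orthonormal family `e` that is
mapped by `D` to multiples of an orthonormal family, then almost every `φ x` lies in the closed
span of `e`. -/
theorem ae_hasSum_inner_sq_of_vanishing_on_orthogonal (hw : Measurable w)
    (hφ : ∀ x, φ x =ᵐ[π] fun a => w (x, a)) (hK : ∀ x, ‖φ x‖ ≤ K) {ι : Type*} [Countable ι]
    {μ : ι → Lp ℝ 2 ν} {e : ι → Lp ℝ 2 π} {s : ι → ℝ} (hμ : Orthonormal ℝ μ)
    (he : Orthonormal ℝ e)
    (hDe : ∀ i, featureOp ν (stronglyMeasurable_inner_section hw hφ) hK (e i) = s i • μ i)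
    (hD0 : ∀ g, (∀ i, inner ℝ (e i) g = 0) →
      featureOp ν (stronglyMeasurable_inner_section hw hφ) hK g = 0) :
    ∀ᵐ x ∂ν, HasSum (fun i => inner ℝ (φ x) (e i) ^ 2) (‖φ x‖ ^ 2) := by
  set D := featureOp ν (stronglyMeasurable_inner_section hw hφ) hK with hD
  set W := (memLp_of_section (ν := ν) hw hφ hK).toLp w with hW
  have hb := orthonormal_prodTensor hμ he
  have hbW : ∀ i, inner ℝ (prodTensor (μ i) (e i)) W = s i := fun i => by
    rw [inner_prodTensor_section hw hφ hK, ← hD, hDe, inner_smul_right,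
      real_inner_self_eq_norm_sq, hμ.1]
    simp
  have hs : Summable fun i => s i ^ 2 := by
    have := hb.inner_products_summable (x := W)
    simpa [hbW] using this
  have hp := (summable_smul_of_orthonormal hb hs).hasSum
  set p := ∑' i, s i • prodTensor (μ i) (e i)
  -- Singular value expansion of the kernel, tested on tensors `f ⊗ g`. Replacing `g` by its
  -- projection onto the closed span of `e` does not change `D g`.
  have hWp : W = p := by
    refine sub_eq_zero.1 (eq_zero_of_forall_inner_prodTensor fun f g => ?_)
    rw [inner_sub_right, sub_eq_zero, inner_prodTensor_section hw hφ hK, ← hD]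
    have hg : Summable fun i => inner ℝ (e i) g ^ 2 := by
      simpa using he.inner_products_summable (x := g)
    have hgs := (summable_smul_of_orthonormal he hg).hasSum
    set g' := ∑' i, inner ℝ (e i) g • e i
    have hgg : D g = D g' := by
      rw [← sub_eq_zero, ← map_sub]
      refine hD0 _ fun i => ?_
      rw [inner_sub_right, inner_eq_of_hasSum_smul he hgs, sub_self]
    have h1 := (hgs.mapL D).mapL (innerSL ℝ f)
    have h2 := hp.mapL (innerSL ℝ (prodTensor f g))
    rw [hgg]
    refine h1.unique (h2.congr_fun fun i => ?_)
    simp only [map_smul, hDe, innerSL_apply_apply, inner_prodTensor, smul_eq_mul]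
    rw [real_inner_comm g (e i)]
    ring
  have hnorm : HasSum (fun i => s i ^ 2) (∫ x, ‖φ x‖ ^ 2 ∂ν) := by
    rw [← norm_sq_toLp_section hw hφ hK, ← hW, hWp]
    exact hasSum_sq_of_hasSum_smul hb hp
  have hInt : ∀ i, ∫ x, inner ℝ (φ x) (e i) ^ 2 ∂ν = s i ^ 2 := fun i => by
    rw [← norm_sq_featureOp ν (stronglyMeasurable_inner_section hw hφ) hK, ← hD, hDe, norm_smul,
      hμ.1]
    simp
  have hle : ∀ x, ∑' i, inner ℝ (φ x) (e i) ^ 2 ≤ ‖φ x‖ ^ 2 := fun x => by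
    have := he.tsum_inner_products_le (x := φ x)
    simpa [real_inner_comm] using this
  have hsx : ∀ x, Summable fun i => inner ℝ (φ x) (e i) ^ 2 := fun x => by
    have := he.inner_products_summable (x := φ x)
    simpa [real_inner_comm] using this
  have hii : ∀ i, Integrable (fun x => inner ℝ (φ x) (e i) ^ 2) ν := fun i =>
    integrable_inner_sq ν (stronglyMeasurable_inner_section hw hφ) hK (e i)
  have hts := hasSum_integral_of_summable_integral_norm hii (by simpa [hInt] using hs)
  simp_rw [hInt] at hts
  -- Both sides equal `∑ sᵢ²`. The defect in Bessel's inequality is nonnegative with integral zero,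
  -- so it vanishes almost everywhere.
  have hIeq : ∫ x, ‖φ x‖ ^ 2 ∂ν = ∫ x, ∑' i, inner ℝ (φ x) (e i) ^ 2 ∂ν := hnorm.unique hts
  have hφi := integrable_norm_sq_section (ν := ν) hw hφ hK
  have hti : Integrable (fun x => ∑' i, inner ℝ (φ x) (e i) ^ 2) ν := by
    refine hφi.mono' ?_ (Filter.Eventually.of_forall fun x => ?_)
    · exact (Measurable.tsum fun i => ((stronglyMeasurable_inner_section hw hφ
        (e i)).measurable.pow_const 2)).aestronglyMeasurable
    · rw [Real.norm_eq_abs, abs_of_nonneg (tsum_nonneg fun i => sq_nonneg _)]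
      exact hle x
  have h0 : ∫ x, (‖φ x‖ ^ 2 - ∑' i, inner ℝ (φ x) (e i) ^ 2) ∂ν = 0 := by
    rw [integral_sub hφi hti, hIeq, sub_self]
  have h1 := (integral_eq_zero_iff_of_nonneg (fun x => sub_nonneg.2 (hle x)) (hφi.sub hti)).1 h0
  filter_upwards [h1] with x hx
  have : ‖φ x‖ ^ 2 = ∑' i, inner ℝ (φ x) (e i) ^ 2 := sub_eq_zero.1 hx
  rw [this]
  exact (hsx x).hasSum

end ProductSpace

/-! ### Mercer representation of the kernel -/

section Mercer

variable {X A : Type*} [MeasurableSpace X] [MeasurableSpace A]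
  {ν : Measure X} {π : Measure A} [IsProbabilityMeasure ν] [IsProbabilityMeasure π]
  {w : X × A → ℝ} {φ : X → Lp ℝ 2 π} {K : ℝ}

-- The factorization `T_k = D D†`, which turns eigenfunctions of the kernel into left singular
-- vectors of `D`.
open ContinuousLinearMap in
lemma integralOperator_ae_eq (hw : Measurable w) (hφ : ∀ x, φ x =ᵐ[π] fun a => w (x, a))
    (hK : ∀ x, ‖φ x‖ ≤ K) {k : X → X → ℝ}
    (hk : ∀ᵐ x ∂ν, ∀ᵐ y ∂ν, k x y = inner ℝ (φ x) (φ y)) (f : Lp ℝ 2 ν) :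
    integralOperator ν k f =ᵐ[ν] featureOp ν (stronglyMeasurable_inner_section hw hφ) hK
      (adjoint (featureOp ν (stronglyMeasurable_inner_section hw hφ) hK) f) := by
  set hm := stronglyMeasurable_inner_section hw hφ
  filter_upwards [hk, featureOp_ae ν hm hK (adjoint (featureOp ν hm hK) f)] with x hx hx'
  rw [hx', real_inner_comm, adjoint_inner_left, inner_featureOp, integralOperator]
  refine integral_congr_ae ?_
  filter_upwards [hx] with y hy
  rw [hy, real_inner_comm]

open ContinuousLinearMap in
lemma isEigenfunction_iff (hw : Measurable w) (hφ : ∀ x, φ x =ᵐ[π] fun a => w (x, a))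
    (hK : ∀ x, ‖φ x‖ ≤ K) {k : X → X → ℝ}
    (hk : ∀ᵐ x ∂ν, ∀ᵐ y ∂ν, k x y = inner ℝ (φ x) (φ y)) (c : ℝ) (f : Lp ℝ 2 ν) :
    IsEigenfunction ν k c f ↔ featureOp ν (stronglyMeasurable_inner_section hw hφ) hK
      (adjoint (featureOp ν (stronglyMeasurable_inner_section hw hφ) hK) f) = c • f := by
  have h1 := integralOperator_ae_eq hw hφ hK hk f
  have h2 := Lp.coeFn_smul c f
  rw [IsEigenfunction, Lp.ext_iff]
  constructor
  · intro h
    filter_upwards [h, h1, h2] with x hx hx1 hx2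
    rw [← hx1, hx, hx2]; rfl
  · intro h
    filter_upwards [h, h1, h2] with x hx hx1 hx2
    rw [hx1, hx, hx2]; rfl

open ContinuousLinearMap in
/-- A Mercer representation: the features `φ` can be replaced by features in `ℓ²`, with coordinates
given by the eigenfunctions of the kernel. -/
theorem exists_feature_representation (hw : Measurable w)
    (hφ : ∀ x, φ x =ᵐ[π] fun a => w (x, a)) (hK : ∀ x, ‖φ x‖ ≤ K) {k : X → X → ℝ}
    (hk : ∀ᵐ x ∂ν, ∀ᵐ y ∂ν, k x y = inner ℝ (φ x) (φ y))
    (h0 : ∀ g, ∫ x, inner ℝ (φ x) g ∂ν = 0) {s : ℕ → ℝ} {μ : ℕ → Lp ℝ 2 ν}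
    (hsμ : IsEigensystem ν k s μ) :
    ∃ (C : X → lp (fun _ : {i // s i ≠ 0} => ℝ) 2)
      (F : lp (fun _ : {i // s i ≠ 0} => ℝ) 2 →L[ℝ] Lp ℝ 2 ν),
      StronglyMeasurable C ∧ (∀ x, ‖C x‖ ≤ K) ∧
      (∀ᵐ x ∂ν, ∀ y, inner ℝ (C x) (C y) = inner ℝ (φ x) (φ y)) ∧
      (∀ p, HasSum (fun i : {i // s i ≠ 0} => (s i * p i) • μ i) (F p)) ∧
      (∀ p, F p =ᵐ[ν] fun x => inner ℝ (C x) p) ∧ ∀ p, ∫ x, F p x ∂ν = 0 := by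
  classical
  set hm := stronglyMeasurable_inner_section hw hφ
  set D := featureOp ν hm hK with hD
  have hμo := hsμ.orthonormal
  have hDD : ∀ i : {i // s i ≠ 0}, D (adjoint D (μ i)) = (s i ^ 2) • μ i := fun i =>
    (isEigenfunction_iff hw hφ hK hk _ _).1 (hsμ.eigen i i.2)
  -- The right singular vectors of `D`.
  set e : {i // s i ≠ 0} → Lp ℝ 2 π := fun i => (s i)⁻¹ • adjoint D (μ i) with hedef
  have hDe : ∀ i, D (e i) = s i • μ i := fun i => by
    rw [hedef, map_smul, hDD, smul_smul]
    congr 1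
    have := i.2
    field_simp
  have he : Orthonormal ℝ e := by
    rw [orthonormal_iff_ite] at hμo ⊢
    intro i j
    have h1 : inner ℝ (e i) (e j) = (s i)⁻¹ * (s j * inner ℝ (μ i) (μ j)) := by
      rw [← inner_smul_right, ← hDe, hedef]
      simp only [inner_smul_left, adjoint_inner_left, RCLike.conj_to_real]
    rw [h1, hμo]
    have := i.2
    split_ifs with hij
    · subst hij; field_simp
    · simp
  have hD0 : ∀ g, (∀ i, inner ℝ (e i) g = 0) → D g = 0 := fun g hg => by
    refine apply_eq_zero_of_forall_inner_adjoint_eq_zero D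
      (isCompactOperator_featureOp ν hm hK) (fun i : {i // s i ≠ 0} => μ i) _ hDD
      (fun a f ha haf hf => ?_) g fun i => ?_
    · exact hsμ.exhaustive a f ha ((isEigenfunction_iff hw hφ hK hk _ _).2 haf)
        fun i hi => hf ⟨i, hi⟩
    · have h1 := hg i
      rw [hedef] at h1
      simp only [inner_smul_left, RCLike.conj_to_real] at h1
      exact (mul_eq_zero.1 h1).resolve_left (inv_ne_zero i.2)
  have hpars := ae_hasSum_inner_sq_of_vanishing_on_orthogonal hw hφ hK hμo he hDe hD0
  set J := (orthonormalEmbedding he).toContinuousLinearMap with hJ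
  have hJsum : ∀ p, HasSum (fun i => p i • e i) (J p) := hasSum_orthonormalEmbedding he
  set C : X → lp (fun _ : {i // s i ≠ 0} => ℝ) 2 := fun x => adjoint J (φ x) with hC
  have hJn : ∀ p, ‖J p‖ = ‖p‖ := (orthonormalEmbedding he).norm_map
  have hJadj : ‖adjoint J‖ ≤ 1 := by
    rw [LinearIsometryEquiv.norm_map]
    exact ContinuousLinearMap.opNorm_le_bound _ zero_le_one fun p => by rw [hJn, one_mul]
  have hCp : ∀ x p, inner ℝ (C x) p = inner ℝ (φ x) (J p) := fun x p => adjoint_inner_left _ _ _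
  have hCi : ∀ x i, C x i = inner ℝ (φ x) (e i) := fun x i => by
    have h1 : J (lp.single 2 i 1) = e i := by
      refine (hJsum _).unique ?_
      refine (hasSum_ite_eq i (e i)).congr_fun fun j => ?_
      by_cases hij : j = i
      · subst hij; simp
      · simp [hij, lp.single_apply]
    rw [← h1, ← hCp, lp.inner_single_right]
    simp
  have hCn : ∀ x, ‖C x‖ ≤ ‖φ x‖ := fun x => by
    refine (ContinuousLinearMap.le_opNorm _ _).trans ?_
    exact mul_le_of_le_one_left (norm_nonneg _) hJadj
  refine ⟨C, D ∘L J, ?_, fun x => (hCn x).trans (hK x), ?_, fun p => ?_, fun p => ?_, fun p => ?_⟩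
  · refine stronglyMeasurable_lp fun i => ?_
    simp_rw [hCi]
    exact (hm (e i)).measurable
  -- Equality in Bessel puts `φ x` in the range of `J`. Only one of the two points has to be good,
  -- so `y` stays arbitrary.
  · filter_upwards [hpars] with x hx y
    have hCx : ‖C x‖ ^ 2 = ‖φ x‖ ^ 2 := by
      refine (lp_hasSum_sq (C x)).unique ?_
      simpa [hCi] using hx
    have hJC : J (C x) = φ x := by
      rw [← sub_eq_zero, ← norm_eq_zero, ← sq_eq_zero_iff, norm_sub_sq_real,
        real_inner_comm, ← hCp, real_inner_self_eq_norm_sq, hJn, hCx]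
      ring
    rw [real_inner_comm, hCp, hJC, real_inner_comm]
  · have h1 := (hJsum p).mapL D
    refine h1.congr_fun fun i => ?_
    rw [map_smul, hDe, smul_smul, mul_comm]
  · filter_upwards [featureOp_ae ν hm hK (J p)] with x hx
    rw [hCp]; exact hx
  · exact (integral_congr_ae (featureOp_ae ν hm hK (J p))).trans (h0 (J p))

end Mercer

/-! ### The centered dual kernel and its features -/

section DualKernel

variable {X A : Type*} [MeasurableSpace X] [MeasurableSpace A]

lemma measurable_jointDensity (P : Measure (X × A)) :
    Measurable fun z : X × A => jointDensity P z.1 z.2 := Measure.measurable_rnDeriv _ _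

/-- By absolute continuity, integrating the density over `X × T` gives back the marginal mass of
`T`. -/
lemma ae_lintegral_jointDensity_left (P : Measure (X × A)) [IsProbabilityMeasure P]
    (hac : P.AbsolutelyContinuous (P.fst.prod P.snd)) :
    ∀ᵐ a ∂P.snd, ∫⁻ x, jointDensity P x a ∂P.fst = 1 := by
  have hm := measurable_jointDensity P
  have hwd := Measure.withDensity_rnDeriv_eq P (P.fst.prod P.snd) hac
  refine ae_eq_of_forall_setLIntegral_eq_of_sigmaFinite hm.lintegral_prod_left' measurable_const
    fun T hT _ => ?_
  simp only [lintegral_const, one_mul, Measure.restrict_apply_univ]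
  have h1 : P.snd T = P (Set.univ ×ˢ T) := by
    rw [Measure.snd_apply hT]; congr 1; ext z; simp
  rw [h1]
  conv_rhs => rw [← hwd]
  rw [withDensity_apply _ (MeasurableSet.univ.prod hT), ← Measure.prod_restrict,
    lintegral_prod_symm' _ (Measure.measurable_rnDeriv _ _), Measure.restrict_univ]
  rfl

lemma ae_lintegral_jointDensity_right (P : Measure (X × A)) [IsProbabilityMeasure P]
    (hac : P.AbsolutelyContinuous (P.fst.prod P.snd)) :
    ∀ᵐ x ∂P.fst, ∫⁻ a, jointDensity P x a ∂P.snd = 1 := by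
  have hm := measurable_jointDensity P
  have hwd := Measure.withDensity_rnDeriv_eq P (P.fst.prod P.snd) hac
  refine ae_eq_of_forall_setLIntegral_eq_of_sigmaFinite hm.lintegral_prod_right' measurable_const
    fun T hT _ => ?_
  simp only [lintegral_const, one_mul, Measure.restrict_apply_univ]
  have h1 : P.fst T = P (T ×ˢ Set.univ) := by
    rw [Measure.fst_apply hT]; congr 1; ext z; simp
  rw [h1]
  conv_rhs => rw [← hwd]
  rw [withDensity_apply _ (hT.prod MeasurableSet.univ), ← Measure.prod_restrict,
    lintegral_prod _ (Measure.measurable_rnDeriv _ _).aemeasurable, Measure.restrict_univ]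
  rfl

lemma essSup_eq_ofReal (P : Measure (X × A)) (hκ : contextComplexity P ≠ ⊤) :
    essSup (fun x => ∫⁻ a, jointDensity P x a ^ 2 ∂P.snd) P.fst =
      ENNReal.ofReal ((contextComplexity P).toReal ^ 2) := by
  rw [ENNReal.ofReal_pow ENNReal.toReal_nonneg, ENNReal.ofReal_toReal hκ, contextComplexity,
    ← ENNReal.rpow_natCast, ← ENNReal.rpow_mul]
  norm_num

/-- The points whose conditional density is normalized, with second moment at most `κ²`. -/
def regularPoints (P : Measure (X × A)) : Set X :=
  {x | ∫⁻ a, jointDensity P x a ^ 2 ∂P.snd ≤ ENNReal.ofReal ((contextComplexity P).toReal ^ 2) ∧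
    ∫⁻ a, jointDensity P x a ∂P.snd = 1}

lemma measurableSet_regularPoints (P : Measure (X × A)) [IsProbabilityMeasure P] :
    MeasurableSet (regularPoints P) := by
  have hm := measurable_jointDensity P
  exact (measurableSet_le (hm.pow_const 2).lintegral_prod_right' measurable_const).inter
    (measurableSet_eq_fun hm.lintegral_prod_right' measurable_const)

lemma ae_mem_regularPoints (P : Measure (X × A)) [IsProbabilityMeasure P]
    (hac : P.AbsolutelyContinuous (P.fst.prod P.snd)) (hκ : contextComplexity P ≠ ⊤) :
    ∀ᵐ x ∂P.fst, x ∈ regularPoints P := by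
  filter_upwards [ae_lintegral_jointDensity_right P hac,
    ENNReal.ae_le_essSup (μ := P.fst) fun x => ∫⁻ a, jointDensity P x a ^ 2 ∂P.snd] with x h1 h2
  rw [essSup_eq_ofReal P hκ] at h2
  exact ⟨h2, h1⟩

open Classical in
/-- The centered density `r(x,a) - 1`, set to zero off the regular points. -/
def centeredDensity (P : Measure (X × A)) (z : X × A) : ℝ :=
  if z.1 ∈ regularPoints P then (jointDensity P z.1 z.2).toReal - 1 else 0

variable (P : Measure (X × A)) [IsProbabilityMeasure P]

lemma measurable_centeredDensity : Measurable (centeredDensity P) := by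
  classical
  refine Measurable.ite (measurable_fst (measurableSet_regularPoints P)) ?_ measurable_const
  exact (measurable_jointDensity P).ennreal_toReal.sub_const 1

variable {P}

lemma integrable_sq_jointDensity {x : X} (hx : x ∈ regularPoints P) :
    Integrable (fun a => (jointDensity P x a).toReal ^ 2) P.snd := by
  have hm : Measurable fun a => jointDensity P x a :=
    (measurable_jointDensity P).comp measurable_prodMk_left
  simp_rw [← ENNReal.toReal_pow]
  exact integrable_toReal_of_lintegral_ne_top (hm.pow_const 2).aemeasurable
    (ne_top_of_le_ne_top ENNReal.ofReal_ne_top hx.1)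

lemma memLp_jointDensity {x : X} (hx : x ∈ regularPoints P) :
    MemLp (fun a => (jointDensity P x a).toReal) 2 P.snd := by
  have hm : Measurable fun a => jointDensity P x a :=
    (measurable_jointDensity P).comp measurable_prodMk_left
  exact (memLp_two_iff_integrable_sq hm.ennreal_toReal.aestronglyMeasurable).2
    (integrable_sq_jointDensity hx)

lemma integral_jointDensity {x : X} (hx : x ∈ regularPoints P) :
    ∫ a, (jointDensity P x a).toReal ∂P.snd = 1 := by
  have hm : Measurable fun a => jointDensity P x a :=
    (measurable_jointDensity P).comp measurable_prodMk_left
  rw [integral_toReal hm.aemeasurable (ae_lt_top hm (by rw [hx.2]; simp)), hx.2]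
  simp

lemma integral_sq_jointDensity_le {x : X} (hx : x ∈ regularPoints P) :
    ∫ a, (jointDensity P x a).toReal ^ 2 ∂P.snd ≤ (contextComplexity P).toReal ^ 2 := by
  have hm : Measurable fun a => jointDensity P x a :=
    (measurable_jointDensity P).comp measurable_prodMk_left
  have hpow : ∀ a, (jointDensity P x a).toReal ^ 2 = (jointDensity P x a ^ 2).toReal := fun a =>
    (ENNReal.toReal_pow _ _).symm
  simp_rw [hpow]
  rw [integral_toReal (hm.pow_const 2).aemeasurable (ae_lt_top (hm.pow_const 2)
    (ne_top_of_le_ne_top ENNReal.ofReal_ne_top hx.1))]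
  exact ENNReal.toReal_le_of_le_ofReal (sq_nonneg _) hx.1

variable (P) in
lemma memLp_centeredDensity (x : X) : MemLp (fun a => centeredDensity P (x, a)) 2 P.snd := by
  by_cases hx : x ∈ regularPoints P
  · simp only [centeredDensity, hx, if_true]
    exact (memLp_jointDensity hx).sub (memLp_const 1)
  · simp [centeredDensity, hx]

variable (P) in
/-- The centered feature map of the dual kernel. -/
def centeredFeature (x : X) : Lp ℝ 2 P.snd := (memLp_centeredDensity P x).toLp _

lemma centeredFeature_ae (x : X) :
    centeredFeature P x =ᵐ[P.snd] fun a => centeredDensity P (x, a) :=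
  (memLp_centeredDensity P x).coeFn_toLp

lemma inner_centeredFeature (x y : X) : inner ℝ (centeredFeature P x) (centeredFeature P y) =
    ∫ a, centeredDensity P (x, a) * centeredDensity P (y, a) ∂P.snd := by
  rw [L2.inner_def]
  refine integral_congr_ae ?_
  filter_upwards [centeredFeature_ae x, centeredFeature_ae y] with a h1 h2
  rw [h1, h2]; simp [mul_comm]

/-- Expand `(r - 1)(r' - 1)` and use that both densities integrate to one. -/
lemma dualKernel_eq {x y : X} (hx : x ∈ regularPoints P) (hy : y ∈ regularPoints P) :
    dualKernel P x y = inner ℝ (centeredFeature P x) (centeredFeature P y) + 1 := by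
  have hix := (memLp_jointDensity hx).integrable (by norm_num : (1 : ℝ≥0∞) ≤ 2)
  have hiy := (memLp_jointDensity hy).integrable (by norm_num : (1 : ℝ≥0∞) ≤ 2)
  have hxy : Integrable (fun a => (jointDensity P x a).toReal * (jointDensity P y a).toReal)
    P.snd := (memLp_jointDensity hx).integrable_mul (memLp_jointDensity hy)
  rw [inner_centeredFeature, dualKernel]
  simp only [centeredDensity, hx, hy, if_true]
  have : ∀ a, ((jointDensity P x a).toReal - 1) * ((jointDensity P y a).toReal - 1) =
      (jointDensity P x a).toReal * (jointDensity P y a).toReal - (jointDensity P x a).toReal -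
        (jointDensity P y a).toReal + 1 := fun a => by ring
  simp_rw [this]
  have h1 : Integrable (fun a => (jointDensity P x a).toReal * (jointDensity P y a).toReal -
    (jointDensity P x a).toReal) P.snd := hxy.sub hix
  have h2 : Integrable (fun a => (jointDensity P x a).toReal * (jointDensity P y a).toReal -
    (jointDensity P x a).toReal - (jointDensity P y a).toReal) P.snd := h1.sub hiy
  rw [integral_add h2 (integrable_const _), integral_sub h1 hiy,
    integral_sub hxy hix, integral_jointDensity hx, integral_jointDensity hy]
  simp

/-- The square norm is `k_X⁺(x,x) - 1` at regular points. The truncation to zero elsewhere makes the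
bound hold at every point. -/
lemma norm_centeredFeature_le (x : X) :
    ‖centeredFeature P x‖ ≤ (contextComplexity P).toReal := by
  refine le_of_sq_le_sq ?_ ENNReal.toReal_nonneg
  rw [← real_inner_self_eq_norm_sq]
  by_cases hx : x ∈ regularPoints P
  · have h1 := dualKernel_eq hx hx
    have h2 := integral_sq_jointDensity_le hx
    simp only [dualKernel, ← sq] at h1
    linarith
  · rw [inner_centeredFeature]
    simp [centeredDensity, hx]

lemma one_le_contextComplexity_sq (hac : P.AbsolutelyContinuous (P.fst.prod P.snd))
    (hκ : contextComplexity P ≠ ⊤) : 1 ≤ (contextComplexity P).toReal ^ 2 := by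
  obtain ⟨x, hx⟩ := (ae_mem_regularPoints P hac hκ).exists
  have h1 := dualKernel_eq hx hx
  have h2 := integral_sq_jointDensity_le hx
  simp only [dualKernel, ← sq, real_inner_self_eq_norm_sq] at h1
  have := sq_nonneg ‖centeredFeature P x‖
  linarith

/-- Fubini, with `r(·,a)` of mean one for almost every `a`. It makes every element of `H_k` have
mean zero, so centering does nothing there. -/
lemma integral_inner_centeredFeature (hac : P.AbsolutelyContinuous (P.fst.prod P.snd))
    (hκ : contextComplexity P ≠ ⊤) (g : Lp ℝ 2 P.snd) :
    ∫ x, inner ℝ (centeredFeature P x) g ∂P.fst = 0 := by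
  have hw := memLp_of_section (ν := P.fst) (measurable_centeredDensity P) centeredFeature_ae
    norm_centeredFeature_le
  have hg : MemLp (fun z : X × A => g z.2) 2 (P.fst.prod P.snd) :=
    (Lp.memLp g).comp_measurePreserving measurePreserving_snd
  have hi : Integrable (fun z : X × A => centeredDensity P z * g z.2) (P.fst.prod P.snd) :=
    hw.integrable_mul hg
  have h1 : ∀ x, inner ℝ (centeredFeature P x) g =
      ∫ a, centeredDensity P (x, a) * g a ∂P.snd := fun x => by
    rw [L2.inner_def]
    refine integral_congr_ae ?_
    filter_upwards [centeredFeature_ae x] with a ha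
    simp [ha, mul_comm]
  simp_rw [h1]
  rw [integral_integral_swap hi]
  refine integral_eq_zero_of_ae ?_
  filter_upwards [ae_lintegral_jointDensity_left P hac] with a ha
  rw [integral_mul_const]
  have hm : Measurable fun x => jointDensity P x a :=
    (measurable_jointDensity P).comp measurable_prodMk_right
  have h2 : ∫ x, centeredDensity P (x, a) ∂P.fst =
      ∫ x, ((jointDensity P x a).toReal - 1) ∂P.fst := by
    refine integral_congr_ae ?_
    filter_upwards [ae_mem_regularPoints P hac hκ] with x hx
    simp [centeredDensity, hx]
  have hInt : Integrable (fun x => (jointDensity P x a).toReal) P.fst :=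
    integrable_toReal_of_lintegral_ne_top hm.aemeasurable (by rw [ha]; simp)
  rw [h2, integral_sub hInt (integrable_const _),
    integral_toReal hm.aemeasurable (ae_lt_top hm (by rw [ha]; simp)), ha]
  simp

/-- All averages of the dual kernel equal one, so centering subtracts exactly the constant one in
`dualKernel_eq`. -/
lemma centeredKernel_dualKernel_eq (hac : P.AbsolutelyContinuous (P.fst.prod P.snd))
    (hκ : contextComplexity P ≠ ⊤) {x y : X} (hx : x ∈ regularPoints P)
    (hy : y ∈ regularPoints P) :
    centeredKernel P.fst (dualKernel P) x y =
      inner ℝ (centeredFeature P x) (centeredFeature P y) := by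
  have hreg := ae_mem_regularPoints P hac hκ
  have hInt : ∀ g, Integrable (fun z => inner ℝ (centeredFeature P z) g) P.fst := fun g =>
    (memLp_inner_feature P.fst (stronglyMeasurable_inner_section (measurable_centeredDensity P)
      centeredFeature_ae) norm_centeredFeature_le g).integrable (by norm_num)
  have hl : ∀ y ∈ regularPoints P, ∫ z, dualKernel P z y ∂P.fst = 1 := fun y hy => by
    have : ∫ z, dualKernel P z y ∂P.fst =
        ∫ z, (inner ℝ (centeredFeature P z) (centeredFeature P y) + 1) ∂P.fst := by
      refine integral_congr_ae ?_
      filter_upwards [hreg] with z hz using dualKernel_eq hz hy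
    rw [this, integral_add (hInt _) (integrable_const _), integral_inner_centeredFeature hac hκ]
    simp
  have hsymm : ∀ x y, dualKernel P x y = dualKernel P y x := fun x y => by
    simp only [dualKernel, mul_comm]
  have hr : ∀ y ∈ regularPoints P, ∫ z, dualKernel P y z ∂P.fst = 1 := fun y hy => by
    simp_rw [hsymm y]; exact hl y hy
  have hd : ∫ z, ∫ z', dualKernel P z z' ∂P.fst ∂P.fst = 1 := by
    have : ∫ z, ∫ z', dualKernel P z z' ∂P.fst ∂P.fst = ∫ _z, (1 : ℝ) ∂P.fst := by
      refine integral_congr_ae ?_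
      filter_upwards [hreg] with z hz using hr z hz
    rw [this]; simp
  rw [centeredKernel, hl y hy, hr x hx, hd, dualKernel_eq hx hy]
  ring

end DualKernel

/-! ### Rank one tensors and projectors in `ℓ² ⊗ ℓ²` -/

section Tensor

variable {ι : Type*}

lemma summable_sq_mul (p q : lp (fun _ : ι => ℝ) 2) :
    Summable fun z : ι × ι => (p z.1 * q z.2) ^ 2 := by
  simp_rw [mul_pow]
  exact (lp_summable_sq p).mul_of_nonneg (lp_summable_sq q) (fun _ => sq_nonneg _)
    fun _ => sq_nonneg _

/-- The tensor product of two vectors of `ℓ²`. -/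
def tens (p q : lp (fun _ : ι => ℝ) 2) : lp (fun _ : ι × ι => ℝ) 2 :=
  ⟨fun z => p z.1 * q z.2, memℓp_two_of_summable (summable_sq_mul p q)⟩

lemma inner_tens (p q p' q' : lp (fun _ : ι => ℝ) 2) :
    inner ℝ (tens p q) (tens p' q') = inner ℝ p p' * inner ℝ q q' := by
  refine (lp_hasSum_inner (tens p q) (tens p' q')).unique ?_
  have h1 := lp_hasSum_inner p p'
  have h2 := lp_hasSum_inner q q'
  have h3 : Summable fun z : ι × ι => (p z.1 * p' z.1) * (q z.2 * q' z.2) :=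
    summable_mul_of_summable_norm h1.summable.norm h2.summable.norm
  refine (h1.mul h2 h3).congr_fun fun z => ?_
  simp only [tens]
  ring

lemma norm_tens_self (p : lp (fun _ : ι => ℝ) 2) : ‖tens p p‖ = ‖p‖ ^ 2 := by
  have h : ‖tens p p‖ ^ 2 = (‖p‖ ^ 2) ^ 2 := by
    rw [← real_inner_self_eq_norm_sq, inner_tens, real_inner_self_eq_norm_sq]; ring
  exact (sq_eq_sq₀ (norm_nonneg _) (by positivity)).1 h

/-- The projector onto the span of an orthonormal family, as an element of `ℓ² ⊗ ℓ²`. -/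
def projector {κ : Type*} [Fintype κ] (q : κ → lp (fun _ : ι => ℝ) 2) :
    lp (fun _ : ι × ι => ℝ) 2 := ∑ i, tens (q i) (q i)

variable {κ : Type*} [Fintype κ] {q : κ → lp (fun _ : ι => ℝ) 2}

/-- The linearization behind the uniform bound: captured energy is linear in the tensor `c ⊗ c`. -/
lemma inner_projector_tens (q : κ → lp (fun _ : ι => ℝ) 2) (c : lp (fun _ : ι => ℝ) 2) :
    inner ℝ (projector q) (tens c c) = ∑ i, inner ℝ c (q i) ^ 2 := by
  rw [projector, sum_inner]
  refine Finset.sum_congr rfl fun i _ => ?_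
  rw [inner_tens, sq, real_inner_comm]

/-- The square of the Hilbert–Schmidt norm of a projector is its rank; this is the `√d` in the
deviation. -/
lemma norm_projector_le (hq : Orthonormal ℝ q) {d : ℕ} (hd : Fintype.card κ ≤ d) :
    ‖projector q‖ ≤ Real.sqrt d := by
  classical
  refine Real.le_sqrt_of_sq_le ?_
  rw [← real_inner_self_eq_norm_sq]
  have : inner ℝ (projector q) (projector q) = (Fintype.card κ : ℝ) := by
    simp only [projector, sum_inner, inner_sum, inner_tens, orthonormal_iff_ite.1 hq]
    simp
  rw [this]
  exact_mod_cast hd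

lemma inner_projector_tens_nonneg (q : κ → lp (fun _ : ι => ℝ) 2) (c : lp (fun _ : ι => ℝ) 2) :
    0 ≤ inner ℝ (projector q) (tens c c) := by
  rw [inner_projector_tens]; positivity

lemma inner_projector_tens_le (hq : Orthonormal ℝ q) (c : lp (fun _ : ι => ℝ) 2) :
    inner ℝ (projector q) (tens c c) ≤ ‖c‖ ^ 2 := by
  rw [inner_projector_tens]
  have := hq.sum_inner_products_le c (s := Finset.univ)
  simpa [real_inner_comm] using this

end Tensor

/-! ### Energy captured by the empirical principal subspace -/

section PrincipalSubspace

variable {X : Type*} [MeasurableSpace X] {ν : Measure X} [IsProbabilityMeasure ν]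
  {s : ℕ → ℝ} {μ : ℕ → Lp ℝ 2 ν} {C : X → lp (fun _ : {i // s i ≠ 0} => ℝ) 2}
  {F : lp (fun _ : {i // s i ≠ 0} => ℝ) 2 →L[ℝ] Lp ℝ 2 ν} {K : ℝ}

lemma hasSum_norm_sq_image (hμ : Orthonormal ℝ fun i : {i // s i ≠ 0} => μ i)
    (hF : ∀ p, HasSum (fun i : {i // s i ≠ 0} => (s i * p i) • μ i) (F p))
    (p : lp (fun _ : {i // s i ≠ 0} => ℝ) 2) :
    HasSum (fun i : {i // s i ≠ 0} => s i ^ 2 * p i ^ 2) (‖F p‖ ^ 2) := by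
  refine (hasSum_sq_of_hasSum_smul hμ (hF p)).congr_fun fun i => ?_
  ring

lemma norm_image_le (hs0 : ∀ i, 0 ≤ s i) (hs : Antitone s)
    (hμ : Orthonormal ℝ fun i : {i // s i ≠ 0} => μ i)
    (hF : ∀ p, HasSum (fun i : {i // s i ≠ 0} => (s i * p i) • μ i) (F p))
    (p : lp (fun _ : {i // s i ≠ 0} => ℝ) 2) : ‖F p‖ ≤ s 0 * ‖p‖ := by
  refine le_of_sq_le_sq ?_ (mul_nonneg (hs0 0) (norm_nonneg _))
  rw [mul_pow]
  refine hasSum_le (fun i => ?_) (hasSum_norm_sq_image hμ hF p) ((lp_hasSum_sq p).mul_left _)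
  have h1 := hs (Nat.zero_le i)
  have h2 := hs0 i
  gcongr

/-- Coordinate vectors of `ℓ²` are orthonormal. -/
lemma orthonormal_single {ι κ : Type*} [DecidableEq ι] {e : κ → ι} (he : Function.Injective e) :
    Orthonormal ℝ fun j => lp.single (E := fun _ : ι => ℝ) 2 (e j) (1 : ℝ) := by
  classical
  rw [orthonormal_iff_ite]
  intro i j
  rw [lp.inner_single_left, lp.single_apply]
  by_cases h : i = j
  · subst h; simp
  · simp [h, he.ne h]

/-- Any `d + 1` orthonormal vectors capture at most the energy of the top eigenvectors. -/
theorem sum_norm_sq_image_le (hs0 : ∀ i, 0 ≤ s i) (hs : Antitone s)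
    (hμ : Orthonormal ℝ fun i : {i // s i ≠ 0} => μ i)
    (hF : ∀ p, HasSum (fun i : {i // s i ≠ 0} => (s i * p i) • μ i) (F p)) {d : ℕ}
    {κ : Type*} [Fintype κ] (hκ : Fintype.card κ = d + 1)
    {q : κ → lp (fun _ : {i // s i ≠ 0} => ℝ) 2} (hq : Orthonormal ℝ q) :
    ∑ k, ‖F (q k)‖ ^ 2 ≤ ∑ l ∈ Finset.range (d + 1), s l ^ 2 := by
  classical
  set J : Finset {i // s i ≠ 0} := (Finset.range (d + 1)).subtype fun i => s i ≠ 0 with hJ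
  have hJmem : ∀ i, i ∈ J ↔ (i : ℕ) ≤ d := fun i => by
    simp [hJ]
  have hSum : HasSum (fun i : {i // s i ≠ 0} => s i ^ 2 * ∑ k, q k i ^ 2)
      (∑ k, ‖F (q k)‖ ^ 2) := by
    simp_rw [Finset.mul_sum]
    exact hasSum_sum fun k _ => hasSum_norm_sq_image hμ hF (q k)
  have hT : HasSum (fun i : {i // s i ≠ 0} => ∑ k, q k i ^ 2) (d + 1 : ℝ) := by
    have h := hasSum_sum fun k (_ : k ∈ Finset.univ) => lp_hasSum_sq (q k)
    have h2 : ∑ k, ‖q k‖ ^ 2 = (d + 1 : ℝ) := by simp [hq.1, hκ]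
    rwa [h2] at h
  have ht1 : ∀ i, ∑ k, q k i ^ 2 ≤ 1 := fun i => by
    have := hq.sum_inner_products_le (lp.single (E := fun _ => ℝ) 2 i (1 : ℝ)) (s := Finset.univ)
    simpa [lp.inner_single_right, lp.norm_single] using this
  have hmono : ∀ i j, i ≤ j → s j ^ 2 ≤ s i ^ 2 := fun i j hij => by
    have h1 := hs hij
    have h2 := hs0 j
    gcongr
  -- Indices start at zero, so `s d ^ 2` is the smallest of the top `d + 1` values. If it vanishes,
  -- `J` may have fewer than `d + 1` elements, but then the mass condition is void.
  have hle := hasSum_mul_le_sum (J := J) (τ := s d ^ 2)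
    (fun i hi => hmono _ _ ((hJmem i).1 hi))
    (fun i hi => hmono _ _ (not_le.1 fun h => hi ((hJmem i).2 h)).le)
    (fun i => Finset.sum_nonneg fun k _ => sq_nonneg _) ht1 hT ?_ hSum
  · refine hle.trans ?_
    rw [hJ, Finset.sum_subtype_eq_sum_filter (f := fun i => s i ^ 2)]
    exact Finset.sum_le_sum_of_subset_of_nonneg (Finset.filter_subset _ _)
      fun i _ _ => sq_nonneg _
  · by_cases hd : s d = 0
    · simp [hd]
    · have hcard : J.card = d + 1 := by
        rw [hJ, Finset.card_subtype, Finset.filter_true_of_mem, Finset.card_range]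
        intro i hi
        have h1 := hs (Nat.lt_succ_iff.1 (Finset.mem_range.1 hi))
        exact (lt_of_lt_of_le (lt_of_le_of_ne (hs0 d) (Ne.symm hd)) h1).ne'
      rw [hcard]; push_cast; exact le_rfl

/-- The mean tensor is the population covariance, whose quadratic form at `p` is `∫ ⟨C x, p⟩² = ‖F
p‖²`. -/
lemma inner_projector_integral (hC : StronglyMeasurable fun x => tens (C x) (C x))
    (hK : ∀ x, ‖C x‖ ≤ K) (hFC : ∀ p, F p =ᵐ[ν] fun x => inner ℝ (C x) p) {κ : Type*} [Fintype κ]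
    (q : κ → lp (fun _ : {i // s i ≠ 0} => ℝ) 2) :
    inner ℝ (projector q) (∫ x, tens (C x) (C x) ∂ν) = ∑ k, ‖F (q k)‖ ^ 2 := by
  have hInt : Integrable (fun x => tens (C x) (C x)) ν := by
    refine Integrable.of_bound hC.aestronglyMeasurable (K ^ 2)
      (Filter.Eventually.of_forall fun x => ?_)
    rw [norm_tens_self]
    have := hK x
    gcongr
  rw [projector, sum_inner]
  refine Finset.sum_congr rfl fun k _ => ?_
  rw [← integral_inner hInt, ← real_inner_self_eq_norm_sq, L2.inner_def]
  refine integral_congr_ae ?_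
  filter_upwards [hFC (q k)] with x hx
  rw [hx, inner_tens, real_inner_comm]
  simp [sq]

/-- With high probability, every orthonormal family captures about as much of the excess energy over
the top eigenvectors as it does empirically. -/
theorem exists_measurableSet_excess_le (hC : StronglyMeasurable C) (hK0 : 0 < K)
    (hK : ∀ x, ‖C x‖ ≤ K) (hμ : Orthonormal ℝ fun i : {i // s i ≠ 0} => μ i)
    (hF : ∀ p, HasSum (fun i : {i // s i ≠ 0} => (s i * p i) • μ i) (F p))
    (hFC : ∀ p, F p =ᵐ[ν] fun x => inner ℝ (C x) p) {m d : ℕ} (hm : 0 < m) (hdm : d ≤ m) {δ : ℝ}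
    (hδ0 : 0 < δ) (hδ1 : δ < 1) :
    ∃ S : Set (Fin m → X), MeasurableSet S ∧
      ENNReal.ofReal (1 - δ) ≤ Measure.pi (fun _ : Fin m => ν) S ∧
      ∀ x ∈ S, ∀ (lam : Fin m → ℝ) (v : Fin m → EuclideanSpace ℝ (Fin m)),
        IsEigendecomposition (Matrix.of fun i j => inner ℝ (C (x i)) (C (x j))) lam v →
        (∀ i : Fin d, 0 < lam (Fin.castLE hdm i)) →
        ∑ l ∈ Finset.range d, s l ^ 2 - deviation K d m δ ≤ ∑ i : Fin d,
          ‖F (empiricalEigenvector (fun j => C (x j)) lam v (Fin.castLE hdm i))‖ ^ 2 := by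
  classical
  have hm' : (0 : ℝ) < m := by exact_mod_cast hm
  have hYm : StronglyMeasurable fun x => tens (C x) (C x) := by
    have hCi : ∀ i, Measurable fun x => C x i := fun i => by
      have h1 : ∀ x, C x i = inner ℝ (C x) (lp.single (E := fun _ => ℝ) 2 i (1 : ℝ)) := fun x => by
        rw [lp.inner_single_right]; simp
      simp_rw [h1]
      exact (hC.inner stronglyMeasurable_const).measurable
    exact stronglyMeasurable_lp fun z => (hCi z.1).mul (hCi z.2)
  have hYK : ∀ x, ‖tens (C x) (C x)‖ ≤ K ^ 2 := fun x => by
    rw [norm_tens_self]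
    have := hK x
    gcongr
  -- The top population eigenvectors. Those with `s j = 0` have no coordinate and contribute no
  -- energy.
  set o : {j : Fin d // s j ≠ 0} → lp (fun _ : {i // s i ≠ 0} => ℝ) 2 := fun j =>
    lp.single 2 ⟨j, j.2⟩ (1 : ℝ) with ho
  have hoo : Orthonormal ℝ o := orthonormal_single (e := fun j : {j : Fin d // s j ≠ 0} =>
    (⟨(j : Fin d), j.2⟩ : {i // s i ≠ 0})) fun i j hij => by
      simp only [Subtype.mk.injEq] at hij
      exact Subtype.ext (Fin.ext hij)
  have hocard : Fintype.card {j : Fin d // s j ≠ 0} ≤ d :=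
    (Fintype.card_subtype_le _).trans (by simp)
  have hosum : ∑ j, ‖F (o j)‖ ^ 2 = ∑ l ∈ Finset.range d, s l ^ 2 := by
    have h1 : ∀ j, ‖F (o j)‖ ^ 2 = s (j : Fin d) ^ 2 := fun j => by
      refine (hasSum_norm_sq_image hμ hF (o j)).unique ?_
      refine (hasSum_ite_eq (⟨(j : Fin d), j.2⟩ : {i // s i ≠ 0}) (s (j : Fin d) ^ 2)).congr_fun
        fun i => ?_
      by_cases hij : i = ⟨(j : Fin d), j.2⟩
      · subst hij; simp [ho]
      · simp [ho, hij, lp.single_apply]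
    simp_rw [h1]
    rw [← Finset.sum_subtype (Finset.univ.filter fun j : Fin d => s j ≠ 0) (by simp)
      (fun j : Fin d => s j ^ 2), Finset.sum_filter_of_ne, Fin.sum_univ_eq_sum_range
      (fun l => s l ^ 2)]
    intro j _ hj h0
    exact hj (by simp [h0])
  -- The family ranges over all orthonormal `q`, because the empirical eigenvectors depend on the
  -- sample.
  obtain ⟨S, hSm, hSp, hS⟩ := exists_measurableSet_forall_inner_empiricalMean_le ν hYm hYK hm
    (I := {q : Fin d → lp (fun _ : {i // s i ≠ 0} => ℝ) 2 // Orthonormal ℝ q})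
    (fun q => projector q.1 - projector o) (b := 2 * Real.sqrt d) (c := 2 * K ^ 2)
    (fun q => by
      have h1 := norm_projector_le q.2 (d := d) (by simp)
      have h2 := norm_projector_le hoo hocard
      exact (norm_sub_le _ _).trans (by linarith))
    (by positivity)
    (fun q x y => by
      simp only [inner_sub_left]
      have h1 := inner_projector_tens_le q.2 (C x)
      have h2 := inner_projector_tens_nonneg q.1 (C y)
      have h3 := inner_projector_tens_nonneg o (C x)
      have h4 := inner_projector_tens_le hoo (C y)
      have h5 := hYK x
      have h6 := hYK y
      rw [norm_tens_self] at h5 h6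
      linarith) hδ0 hδ1
  refine ⟨S, hSm, hSp, fun x hx lam v hv hpos => ?_⟩
  set p : Fin d → lp (fun _ : {i // s i ≠ 0} => ℝ) 2 := fun i =>
    empiricalEigenvector (fun j => C (x j)) lam v (Fin.castLE hdm i) with hp
  have hpo : Orthonormal ℝ p :=
    orthonormal_empiricalEigenvector hv (Fin.castLE_injective hdm) hpos
  have hmean : ∀ {κ : Type} [Fintype κ] (q : κ → lp (fun _ : {i // s i ≠ 0} => ℝ) 2),
      inner ℝ (projector q) (empiricalMean (fun x => tens (C x) (C x)) x) =
        (m : ℝ)⁻¹ * ∑ i, ∑ j, inner ℝ (C (x j)) (q i) ^ 2 := fun q => by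
    rw [empiricalMean, inner_smul_right, inner_sum, Finset.sum_comm]
    simp_rw [inner_projector_tens]
  have h1 := hS x hx ⟨p, hpo⟩
  simp only [inner_sub_left, inner_sub_right, hmean, inner_projector_integral hYm hK hFC,
    hosum] at h1
  -- Empirical optimality of `p`: the empirical part of the deviation in `h1` is nonnegative and can
  -- be dropped.
  have h2 : ∑ i, ∑ j, inner ℝ (C (x j)) (o i) ^ 2 ≤ ∑ i, ∑ j, inner ℝ (C (x j)) (p i) ^ 2 := by
    refine (sum_sum_inner_sq_le_sum_eigenvalues hv hdm hocard hoo).trans (le_of_eq ?_)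
    exact Finset.sum_congr rfl fun i _ => (sum_inner_sq_empiricalEigenvector hv (hpos i)).symm
  have h3 := mul_le_mul_of_nonneg_left h2 (inv_nonneg.2 hm'.le)
  have hlog : 0 ≤ Real.log (1 / δ) := Real.log_nonneg (by rw [le_div_iff₀ hδ0]; linarith)
  have hlog6 : Real.log (1 / δ) ≤ Real.log (6 / δ) :=
    Real.log_le_log (by positivity) (by gcongr; norm_num)
  -- A single one-sided bound costs only `√2 √(log (1/δ))`, within the allowed `3 √(log (6/δ))`.
  have h4 : 2 * Real.sqrt d * (K ^ 2 / Real.sqrt m) +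
      2 * K ^ 2 * Real.sqrt (Real.log (1 / δ) / (2 * m)) ≤ deviation K d m δ := by
    have h5 : Real.sqrt (Real.log (1 / δ) / (2 * m)) ≤
        Real.sqrt (Real.log (6 / δ)) / Real.sqrt m := by
      rw [← Real.sqrt_div (hlog.trans hlog6)]
      refine Real.sqrt_le_sqrt ?_
      gcongr
      · exact hlog.trans hlog6
      · linarith
    have h6 : 0 ≤ Real.sqrt (Real.log (6 / δ)) / Real.sqrt m := by positivity
    calc _ ≤ 2 * Real.sqrt d * (K ^ 2 / Real.sqrt m) +
          3 * K ^ 2 * (Real.sqrt (Real.log (6 / δ)) / Real.sqrt m) := by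
          have : 2 * K ^ 2 * Real.sqrt (Real.log (1 / δ) / (2 * m)) ≤
            3 * K ^ 2 * (Real.sqrt (Real.log (6 / δ)) / Real.sqrt m) := by gcongr; norm_num
          linarith
      _ = deviation K d m δ := by rw [deviation]; ring
  linarith

/-- Vectors orthogonal to `d` orthonormal vectors of nearly maximal energy have small energy. -/
theorem norm_sq_image_le_of_orthogonal (hs0 : ∀ i, 0 ≤ s i) (hs : Antitone s)
    (hμ : Orthonormal ℝ fun i : {i // s i ≠ 0} => μ i)
    (hF : ∀ p, HasSum (fun i : {i // s i ≠ 0} => (s i * p i) • μ i) (F p)) {d : ℕ} {η : ℝ}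
    {p : Fin d → lp (fun _ : {i // s i ≠ 0} => ℝ) 2} (hp : Orthonormal ℝ p)
    (hη : ∑ l ∈ Finset.range d, s l ^ 2 - η ≤ ∑ i, ‖F (p i)‖ ^ 2)
    {h : lp (fun _ : {i // s i ≠ 0} => ℝ) 2} (hh : ∀ i, inner ℝ (p i) h = 0) :
    ‖F h‖ ^ 2 ≤ (s d ^ 2 + η) * ‖h‖ ^ 2 := by
  by_cases h0 : h = 0
  · simp [h0]
  have hn : ‖h‖ ≠ 0 := norm_ne_zero_iff.2 h0
  set u := ‖h‖⁻¹ • h with hu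
  -- The `d + 1` vectors capture at most the top `d + 1` eigenvalues. The `p i` already take the top
  -- `d` up to `η`, which leaves `s d ^ 2 + η` for `u`.
  have hq : Orthonormal ℝ (fun o : Option (Fin d) => o.elim u p) := by
    rw [orthonormal_iff_ite] at hp ⊢
    have hpu : ∀ i, inner ℝ (p i) u = 0 := fun i => by rw [hu, inner_smul_right, hh, mul_zero]
    rintro (_ | i) (_ | j)
    · simp [hu, norm_smul, hn]
    · simp [real_inner_comm, hpu]
    · simp [hpu]
    · simp [hp]
  have h1 := sum_norm_sq_image_le hs0 hs hμ hF (d := d) (by simp) hq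
  rw [Fintype.sum_option, Finset.sum_range_succ] at h1
  simp only [Option.elim] at h1
  have h2 : ‖F u‖ ^ 2 * ‖h‖ ^ 2 = ‖F h‖ ^ 2 := by
    rw [hu, map_smul, norm_smul, norm_inv, norm_norm]
    field_simp
  rw [← h2]
  gcongr
  linarith

end PrincipalSubspace

/-! ### `H_k` as an isometric image of `ℓ²` -/

section InducedRKHS

variable {X : Type*} [MeasurableSpace X] {ν : Measure X} {s : ℕ → ℝ} {μ : ℕ → Lp ℝ 2 ν}
  {F : lp (fun _ : {i // s i ≠ 0} => ℝ) 2 →L[ℝ] Lp ℝ 2 ν}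

lemma inner_image (hμ : Orthonormal ℝ fun i : {i // s i ≠ 0} => μ i)
    (hF : ∀ p, HasSum (fun i : {i // s i ≠ 0} => (s i * p i) • μ i) (F p))
    (p : lp (fun _ : {i // s i ≠ 0} => ℝ) 2) (i : {i // s i ≠ 0}) :
    inner ℝ (μ i) (F p) = s i * p i :=
  inner_eq_of_hasSum_smul hμ (hF p) i

/-- The factors `sᵢ` in the coordinates of `F` cancel the weights `1 / sᵢ²`; where `s i = 0` the
division gives zero. -/
lemma hkInner_image (hμ : Orthonormal ℝ fun i : {i // s i ≠ 0} => μ i)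
    (hF : ∀ p, HasSum (fun i : {i // s i ≠ 0} => (s i * p i) • μ i) (F p))
    (p q : lp (fun _ : {i // s i ≠ 0} => ℝ) 2) : hkInner s μ (F p) (F q) = inner ℝ p q := by
  refine HasSum.tsum_eq ?_
  rw [← hasSum_subtype_iff_of_support_subset (s := {i | s i ≠ 0})]
  · refine (lp_hasSum_inner p q).congr_fun fun i => ?_
    simp only [Function.comp_apply]
    rw [inner_image hμ hF p i, inner_image hμ hF q i]
    have : s i ≠ 0 := i.2
    field_simp
  · intro i hi h0
    exact hi (by simp [h0])

lemma hkNorm_image (hμ : Orthonormal ℝ fun i : {i // s i ≠ 0} => μ i)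
    (hF : ∀ p, HasSum (fun i : {i // s i ≠ 0} => (s i * p i) • μ i) (F p))
    (p : lp (fun _ : {i // s i ≠ 0} => ℝ) 2) : hkNorm s μ (F p) = ‖p‖ := by
  rw [hkNorm, hkInner_image hμ hF, real_inner_self_eq_norm_sq, Real.sqrt_sq (norm_nonneg _)]

lemma mem_inducedRKHS_iff
    (hF : ∀ p, HasSum (fun i : {i // s i ≠ 0} => (s i * p i) • μ i) (F p)) (f : Lp ℝ 2 ν) :
    f ∈ inducedRKHS s μ ↔ ∃ p, F p = f := by
  classical
  have hsupp : ∀ u : ℕ → ℝ, Function.support (fun i => (s i * u i) • μ i) ⊆ {i | s i ≠ 0} :=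
    fun u i hi h0 => hi (by simp [h0])
  constructor
  · rintro ⟨u, hu, hf⟩
    refine ⟨⟨fun i => u i, memℓp_two_of_summable (hu.subtype _)⟩, ?_⟩
    rw [← hasSum_subtype_iff_of_support_subset (hsupp u)] at hf
    exact (hF _).unique hf
  · rintro ⟨p, rfl⟩
    set u : ℕ → ℝ := fun i => if h : s i ≠ 0 then p ⟨i, h⟩ else 0 with hu
    have hup : ∀ i : {i // s i ≠ 0}, u i = p i := fun i => by
      simp only [hu]; rw [dif_pos i.2]
    refine ⟨u, ?_, ?_⟩
    · have h1 : Function.support (fun i => u i ^ 2) ⊆ {i | s i ≠ 0} := fun i hi h0 =>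
        hi (by simp [hu, h0])
      have h2 := (hasSum_subtype_iff_of_support_subset (a := ‖p‖ ^ 2) h1).1
        ((lp_hasSum_sq p).congr_fun fun i => by
          simp only [Function.comp_apply]; rw [hup i])
      exact h2.summable
    · rw [← hasSum_subtype_iff_of_support_subset (hsupp u)]
      refine (hF p).congr_fun fun i => ?_
      simp only [Function.comp_apply]
      rw [hup i]

lemma centered_eq_self [IsProbabilityMeasure ν] {f : Lp ℝ 2 ν} (hf : ∫ x, f x ∂ν = 0) :
    centered f = f := by
  have h : (memLp_const (∫ x, f x ∂ν) : MemLp (fun _ : X => ∫ x, f x ∂ν) 2 ν).toLp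
      (fun _ : X => ∫ x, f x ∂ν) = 0 := by
    refine Lp.ext ((MemLp.coeFn_toLp _).trans ?_)
    filter_upwards [Lp.coeFn_zero ℝ 2 ν] with x hx
    rw [hf, hx]; rfl
  rw [centered, h, sub_zero]

end InducedRKHS

/-! ### The encoder and its projection in `ℓ²` coordinates -/

section KernelPCA

variable {X : Type*} [MeasurableSpace X] {ν : Measure X} [IsProbabilityMeasure ν]
  {s : ℕ → ℝ} {μ : ℕ → Lp ℝ 2 ν} {C : X → lp (fun _ : {i // s i ≠ 0} => ℝ) 2}
  {F : lp (fun _ : {i // s i ≠ 0} => ℝ) 2 →L[ℝ] Lp ℝ 2 ν} {k : X → X → ℝ} {m d : ℕ}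

/-- The kernel trick: expanding `⟨C y, pᵢ⟩` leaves only the kernel values at the sample points. -/
lemma image_empiricalEigenvector_ae (hFC : ∀ p, F p =ᵐ[ν] fun x => inner ℝ (C x) p)
    {x : Fin m → X} (hkx : ∀ j, ∀ᵐ y ∂ν, k y (x j) = inner ℝ (C y) (C (x j))) (hdm : d ≤ m)
    (lam : Fin m → ℝ) (v : Fin m → EuclideanSpace ℝ (Fin m)) (i : Fin d) :
    F (empiricalEigenvector (fun j => C (x j)) lam v (Fin.castLE hdm i)) =ᵐ[ν]
      kpcaEncoder hdm k x lam v i := by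
  filter_upwards [hFC (empiricalEigenvector (fun j => C (x j)) lam v (Fin.castLE hdm i)),
    ae_all_iff.2 hkx] with y hy hky
  rw [hy, empiricalEigenvector, inner_smul_right, combine, inner_sum, kpcaEncoder]
  simp_rw [hky, inner_smul_right]

lemma mem_encoderSpan_iff (hFC : ∀ p, F p =ᵐ[ν] fun x => inner ℝ (C x) p) {Φ : Fin d → X → ℝ}
    {p : Fin d → lp (fun _ : {i // s i ≠ 0} => ℝ) 2} (hΦ : ∀ i, F (p i) =ᵐ[ν] Φ i)
    (g : Lp ℝ 2 ν) : g ∈ encoderSpan Φ ↔ ∃ w : Fin d → ℝ, g = F (∑ i, w i • p i) := by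
  have h1 : ∀ w : Fin d → ℝ, F (∑ i, w i • p i) =ᵐ[ν] fun y => ∑ i, w i * Φ i y := fun w => by
    filter_upwards [hFC (∑ i, w i • p i), ae_all_iff.2 hΦ,
      ae_all_iff.2 fun i => hFC (p i)] with y hy h2 h3
    rw [hy, inner_sum]
    refine Finset.sum_congr rfl fun i _ => ?_
    rw [inner_smul_right, ← h2, h3]
  refine exists_congr fun w => ?_
  constructor
  · exact fun h => Lp.ext (h.trans (h1 w).symm)
  · rintro rfl; exact h1 w

/-- Through the isometry this is projection onto an orthonormal family; the equivalence gives
existence and uniqueness at once. -/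
lemma isHkProjection_iff (hμ : Orthonormal ℝ fun i : {i // s i ≠ 0} => μ i)
    (hF : ∀ p, HasSum (fun i : {i // s i ≠ 0} => (s i * p i) • μ i) (F p))
    (hFC : ∀ p, F p =ᵐ[ν] fun x => inner ℝ (C x) p) {Φ : Fin d → X → ℝ}
    {p : Fin d → lp (fun _ : {i // s i ≠ 0} => ℝ) 2} (hp : Orthonormal ℝ p)
    (hΦ : ∀ i, F (p i) =ᵐ[ν] Φ i) (u : lp (fun _ : {i // s i ≠ 0} => ℝ) 2) (g : Lp ℝ 2 ν) :
    IsHkProjection s μ Φ (F u) g ↔ g = F (∑ i, inner ℝ (p i) u • p i) := by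
  have hinner : ∀ (w : Fin d → ℝ) i, inner ℝ (p i) (∑ j, w j • p j) = w i := fun w i =>
    hp.inner_right_fintype w i
  constructor
  · rintro ⟨hg, horth⟩
    obtain ⟨w, rfl⟩ := (mem_encoderSpan_iff hFC hΦ g).1 hg
    congr 1
    refine Finset.sum_congr rfl fun i _ => ?_
    have h1 := horth (F (p i)) ((mem_encoderSpan_iff hFC hΦ _).2 ⟨Pi.single i 1, by
      simp [Pi.single_apply]⟩)
    rw [← map_sub, hkInner_image hμ hF, inner_sub_left, sub_eq_zero, real_inner_comm,
      real_inner_comm (p i) (∑ _, _), hinner] at h1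
    rw [h1]
  · rintro rfl
    refine ⟨(mem_encoderSpan_iff hFC hΦ _).2 ⟨_, rfl⟩, fun h hh => ?_⟩
    obtain ⟨w, rfl⟩ := (mem_encoderSpan_iff hFC hΦ h).1 hh
    rw [← map_sub, hkInner_image hμ hF, inner_sum]
    refine Finset.sum_eq_zero fun i _ => ?_
    rw [inner_smul_right, inner_sub_left, real_inner_comm, real_inner_comm _ (∑ _, _), hinner,
      sub_self, mul_zero]

end KernelPCA

end Contexture

end

/-! ### Assembly of the main theorem -/

open Contexture

theorem mainTheorem5 {X A : Type*} [MeasurableSpace X] [MeasurableSpace A]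
    (P : MeasureTheory.Measure (X × A)) [MeasureTheory.IsProbabilityMeasure P]
    (hac : P.AbsolutelyContinuous (P.fst.prod P.snd))
    (hκ : Contexture.contextComplexity P ≠ ⊤)
    (k : X → X → ℝ) (hk : k = Contexture.centeredKernel P.fst (Contexture.dualKernel P))
    (s : ℕ → ℝ) (μ : ℕ → MeasureTheory.Lp ℝ 2 P.fst)
    (hsμ : Contexture.IsEigensystem P.fst k s μ)
    (m d : ℕ) (hm : 0 < m) (hdm : d ≤ m)
    (ε : ℝ) (hε0 : 0 < ε) (hε1 : ε < 1) (hεs : (1 - ε) ^ 2 < s 0 ^ 2)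
    (δ : ℝ) (hδ0 : 0 < δ) (hδ1 : δ < 1)
    (η : ℝ) (hη : η = Contexture.deviation (Contexture.contextComplexity P).toReal d m δ)
    (hden : 0 < s 0 ^ 2 - s d ^ 2 - η) :
    ∃ S : Set (Fin m → X), MeasurableSet S ∧
      ENNReal.ofReal (1 - δ) ≤ MeasureTheory.Measure.pi (fun _ : Fin m => P.fst) S ∧
      ∀ x ∈ S, ∀ (lam : Fin m → ℝ) (v : Fin m → EuclideanSpace ℝ (Fin m)),
        Contexture.IsEigendecomposition (Contexture.gramMatrix k x) lam v →
        (∀ i : Fin d, 0 < lam (Fin.castLE hdm i)) →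
        (∀ i : Fin d, ∃ g ∈ Contexture.inducedRKHS s μ,
          g =ᵐ[P.fst] Contexture.kpcaEncoder hdm k x lam v i) ∧
        ∀ f ∈ Contexture.compatibleClass s μ ε,
          ∃ fΦ : MeasureTheory.Lp ℝ 2 P.fst,
            (∀ g, Contexture.IsHkProjection s μ (Contexture.kpcaEncoder hdm k x lam v) f g ↔
              g = fΦ) ∧
            Contexture.hkNorm s μ (f - fΦ) ^ 2 ≤
              (s 0 ^ 2 - (1 - ε) ^ 2 + s 0 * Real.sqrt (s d ^ 2 + η)) /
                (s 0 ^ 2 - s d ^ 2 - η) * (‖f‖ ^ 2 / (1 - ε) ^ 2) ∧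
            ‖f - fΦ‖ ^ 2 ≤
              (s 0 ^ 2 - (1 - ε) ^ 2 + s 0 * Real.sqrt (s d ^ 2 + η)) /
                (s 0 ^ 2 - s d ^ 2 - η) * (s 0 ^ 2 * ‖f‖ ^ 2 / (1 - ε) ^ 2) := by
  subst hk
  have hreg := ae_mem_regularPoints P hac hκ
  have hk : ∀ᵐ x ∂P.fst, ∀ᵐ y ∂P.fst, centeredKernel P.fst (dualKernel P) x y =
      inner ℝ (centeredFeature P x) (centeredFeature P y) := by
    filter_upwards [hreg] with x hx
    filter_upwards [hreg] with y hy
    exact centeredKernel_dualKernel_eq hac hκ hx hy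
  obtain ⟨C, F, hCm, hCK, hCin, hF, hFC, hF0⟩ := exists_feature_representation
    (measurable_centeredDensity P) centeredFeature_ae norm_centeredFeature_le hk
    (integral_inner_centeredFeature hac hκ) hsμ
  have hμ := hsμ.orthonormal
  have hK0 : 0 < (contextComplexity P).toReal := by
    refine lt_of_le_of_ne ENNReal.toReal_nonneg fun h => ?_
    have := one_le_contextComplexity_sq hac hκ
    rw [← h] at this
    norm_num at this
  obtain ⟨S, hSm, hSp, hS⟩ := exists_measurableSet_excess_le hCm hK0 hCK hμ hF hFC hm hdm hδ0 hδ1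
  rw [← hη] at hS
  have hgood : ∀ᵐ x ∂P.fst, x ∈ regularPoints P ∧ ∀ y, inner ℝ (C x) (C y) =
      inner ℝ (centeredFeature P x) (centeredFeature P y) := hreg.and hCin
  -- The Gram matrix needs kernel values at the sample points, diagonal included, so the exceptional
  -- set is a null set of points, not of pairs. Samples hitting it are discarded at no cost in
  -- probability.
  obtain ⟨N, hNsub, hNm, hN0⟩ := exists_measurable_superset_of_null (ae_iff.1 hgood)
  have hNgood : ∀ x, x ∉ N → x ∈ regularPoints P ∧ ∀ y, inner ℝ (C x) (C y) =
      inner ℝ (centeredFeature P x) (centeredFeature P y) := fun x hx => by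
    by_contra h
    exact hx (hNsub h)
  have hkC : ∀ x y, x ∉ N → y ∉ N →
      centeredKernel P.fst (dualKernel P) x y = inner ℝ (C x) (C y) := fun x y hx hy => by
    rw [centeredKernel_dualKernel_eq hac hκ (hNgood x hx).1 (hNgood y hy).1, (hNgood x hx).2]
  have haeN : ∀ᵐ x ∂P.fst, x ∉ N := measure_eq_zero_iff_ae_notMem.1 hN0
  have haepi : ∀ᵐ x ∂(Measure.pi fun _ : Fin m => P.fst), ∀ j, x j ∉ N := by
    rw [ae_all_iff]
    exact fun j => (measurePreserving_eval (fun _ : Fin m => P.fst)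
      j).quasiMeasurePreserving.ae haeN
  refine ⟨S ∩ {x | ∀ j, x j ∉ N}, hSm.inter ?_, ?_, ?_⟩
  · have : {x : Fin m → X | ∀ j, x j ∉ N} = ⋂ j, (fun x : Fin m → X => x j) ⁻¹' Nᶜ := by
      ext x; simp
    rw [this]
    exact MeasurableSet.iInter fun j => measurable_pi_apply j hNm.compl
  · refine hSp.trans (le_of_eq (measure_congr ?_))
    filter_upwards [haepi] with x hx
    exact propext ⟨fun h => ⟨h, hx⟩, fun h => h.1⟩
  rintro x ⟨hxS, hxN⟩ lam v hv hpos
  have hgram : gramMatrix (centeredKernel P.fst (dualKernel P)) x =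
      Matrix.of fun i j => inner ℝ (C (x i)) (C (x j)) := by
    ext i j
    exact hkC _ _ (hxN i) (hxN j)
  rw [hgram] at hv
  have hexc := hS x hxS lam v hv hpos
  have hkx : ∀ j, ∀ᵐ y ∂P.fst, centeredKernel P.fst (dualKernel P) y (x j) =
      inner ℝ (C y) (C (x j)) := fun j => by
    filter_upwards [haeN] with y hy using hkC _ _ hy (hxN j)
  have hΦ := image_empiricalEigenvector_ae hFC hkx hdm lam v
  have hpo : Orthonormal ℝ fun i : Fin d =>
      empiricalEigenvector (fun j => C (x j)) lam v (Fin.castLE hdm i) :=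
    orthonormal_empiricalEigenvector hv (Fin.castLE_injective hdm) hpos
  generalize hp : (fun i : Fin d =>
    empiricalEigenvector (fun j => C (x j)) lam v (Fin.castLE hdm i)) = p at hpo
  have hpi : ∀ i, empiricalEigenvector (fun j => C (x j)) lam v (Fin.castLE hdm i) = p i :=
    fun i => congrFun hp i
  simp only [hpi] at hexc hΦ
  refine ⟨fun i => ⟨F (p i), (mem_inducedRKHS_iff hF _).2 ⟨_, rfl⟩, hΦ i⟩, ?_⟩
  rintro f ⟨hfH, -, hfε⟩
  obtain ⟨u, rfl⟩ := (mem_inducedRKHS_iff hF f).1 hfH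
  -- As `F u` has mean zero, compatibility reads `(1 - ε) ‖u‖ ≤ ‖F u‖`.
  rw [centered_eq_self (hF0 u), hkNorm_image hμ hF] at hfε
  set u₁ := ∑ i, inner ℝ (p i) u • p i with hu₁
  set u₂ := u - u₁ with hu₂
  have hpu₂ : ∀ i, inner ℝ (p i) u₂ = 0 := fun i => by
    rw [hu₂, inner_sub_right, hu₁, hpo.inner_right_fintype, sub_self]
  have h12 : inner ℝ u₁ u₂ = 0 := by
    rw [hu₁, sum_inner]
    refine Finset.sum_eq_zero fun i _ => ?_
    rw [inner_smul_left, hpu₂, mul_zero]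
  have hτ : 0 ≤ s d ^ 2 + η := by
    have : 0 ≤ η := by rw [hη, deviation]; positivity
    positivity
  have hε' : 0 < 1 - ε := by linarith
  have hθ : (1 - ε) ^ 2 * ‖u‖ ^ 2 ≤ ‖F u‖ ^ 2 := by
    rw [← mul_pow]; gcongr
  have hgeo := norm_sq_orthogonal_part_le F.toLinearMap (g := u) (g₁ := u₁) (g₂ := u₂)
    (by rw [hu₂]; abel) h12 (hsμ.nonneg 0)
    (norm_image_le hsμ.nonneg hsμ.antitone hμ hF u₁) hτ
    (norm_sq_image_le_of_orthogonal hsμ.nonneg hsμ.antitone hμ hF hpo hexc hpu₂) hθ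
  have hnum : 0 ≤ s 0 ^ 2 - (1 - ε) ^ 2 + s 0 * Real.sqrt (s d ^ 2 + η) := by
    have := mul_nonneg (hsμ.nonneg 0) (Real.sqrt_nonneg (s d ^ 2 + η))
    linarith
  have hu : ‖u‖ ^ 2 ≤ ‖F u‖ ^ 2 / (1 - ε) ^ 2 := by
    rw [le_div_iff₀ (by positivity)]; linarith
  have hbound : ‖u₂‖ ^ 2 ≤ (s 0 ^ 2 - (1 - ε) ^ 2 + s 0 * Real.sqrt (s d ^ 2 + η)) /
      (s 0 ^ 2 - s d ^ 2 - η) * (‖F u‖ ^ 2 / (1 - ε) ^ 2) := by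
    calc ‖u₂‖ ^ 2 ≤ (s 0 ^ 2 - (1 - ε) ^ 2 + s 0 * Real.sqrt (s d ^ 2 + η)) /
        (s 0 ^ 2 - s d ^ 2 - η) * ‖u‖ ^ 2 := by
          rw [div_mul_eq_mul_div, le_div_iff₀ hden]
          linarith
      _ ≤ _ := mul_le_mul_of_nonneg_left hu (div_nonneg hnum hden.le)
  refine ⟨F u₁, isHkProjection_iff hμ hF hFC hpo hΦ u, ?_, ?_⟩
  · rw [← map_sub, hkNorm_image hμ hF]
    exact hbound
  · rw [← map_sub]
    have h1 := norm_image_le hsμ.nonneg hsμ.antitone hμ hF u₂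
    have h2 : ‖F u₂‖ ^ 2 ≤ s 0 ^ 2 * ‖u₂‖ ^ 2 := by rw [← mul_pow]; gcongr
    refine h2.trans ((mul_le_mul_of_nonneg_left hbound (sq_nonneg _)).trans (le_of_eq ?_))
    ring
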